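/- Let $R$ be an associative unital ring and $\mathrm{Mod}\text{-}R$ the category of right $R$-modules. A submodule $P\subseteq M$ is *pure* if $\mathrm{Hom}_R(X,M)\to\mathrm{Hom}_R(X,M/P)$ is surjective for every finitely presented module $X$. A *filtration* of a module $M$ is a family $(M_\alpha\mid\alpha\le\sigma)$ of submodules indexed by an ordinal $\sigma$ with $M_0=0$, $M_\sigma=M$, $M_\alpha\subseteq M_\beta$ for $\alpha<\beta\le\sigma$, and $M_\alpha=\bigcup_{\beta<\alpha}M_\beta$ for each limit ordinal $\alpha\le\sigma$. It is an $\mathcal A$-filtration if $M_{\alpha+1}/M_\alpha$ is isomorphic to a module in $\mathcal A$ for every $\alpha<\sigma$, and it is *pure* if $M_\alpha$ is pure in $M_\sigma$ for every $\alpha<\sigma$. A class $\mathcal A$ is *closed under pure filtrations* if every module possessing a pure $\mathcal A$-filtration belongs to $\mathcal A$. For an infinite regular cardinal $\theta$, a directed system $(N_i,g_{ji}\colon N_i\to N_j\mid i\le j)$ of modules is *$\theta$-continuous* if every nonempty totally ordered set $J$ of indices with $|J|<\theta$ has a supremum $s$ and the canonical map $\varinjlim_{j\in J}N_j\to N_s$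 is an isomorphism. Consider the following two conditions on a cardinal $\kappa$: 1. there is a stationary set $E\subseteq\kappa^+$ consisting of ordinals of cofinality $\theta$ which is non-reflecting, i.e. $E\cap\delta$ is non-stationary in $\delta$ for each ordinal $\delta<\kappa^+$ of uncountable cofinality; 2. $\kappa^{<\theta}=\kappa$. **Proposition.** Let $\theta$ be an infinite regular cardinal, and let $\mathcal A\subseteq\mathrm{Mod}\text{-}R$ be a class of modules closed under isomorphic images, pure filtrations and direct summands. Let $(N_\alpha,g_{\alpha\beta}\colon N_\beta\to N_\alpha\mid\beta<\alpha<\theta)$ be a $\theta$-continuous well-ordered directed system consisting of modules from $\mathcal A$. Let $\kappa\ge|R|+\sum_{\alpha<\theta}|N_\alpha|$ be a cardinal satisfying (1) and (2) for $\theta$, and put $\lambda=\kappa^+$. Then there are a stationary set $F\subseteq\lambda$ and a right $R$-module $L$ possessing a filtration $(L_\alpha\mid\alpha\le\lambda)$ such that * (a) $L_\alpha\in\mathcal A$ and $|L_\alpha|<\lambda$ for each $\alpha<\lambda$; and * (b) for every $\delta\in F$ and every $\varepsilon$ with $\delta<\varepsilon<\lambda$, we have $\varinjlim_{\alpha<\theta}N_\alpha\cong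 L_{\delta+1}/L_\delta$, and $L_{\delta+1}/L_\delta$ is a direct summand of $L_\varepsilon/L_\delta$. -/

import Mathlib

open Cardinal

universe u

namespace EnochsTree

section SetTheory

/-- `E ∩ δ` is a stationary subset of the ordinal `δ`: it meets every closed unbounded subset
of `δ`. -/
def StationaryIn (δ : Ordinal.{u}) (E : Set Ordinal.{u}) : Prop :=
  IsStationary {x : Set.Iio δ | (x : Ordinal.{u}) ∈ E}

/-- `E ⊆ l` is non-reflecting: `E ∩ δ` is non-stationary in `δ` for each ordinal `δ < l` of
uncountable cofinality. -/
def NonReflecting (l : Ordinal.{u}) (E : Set Ordinal.{u}) : Prop :=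
  ∀ δ < l, ℵ₀ < δ.cof → ¬ StationaryIn δ E

/-- The two set-theoretic requirements on `κ` with respect to `θ`:
there is a non-reflecting stationary subset of `κ⁺` consisting of ordinals of cofinality `θ`,
and `κ ^ (< θ) = κ`. -/
structure IsSuitable (θ κ : Cardinal.{u}) : Prop where
  exists_nonReflecting : ∃ E : Set Ordinal.{u},
    E ⊆ Set.Iio (Order.succ κ).ord ∧ StationaryIn (Order.succ κ).ord E ∧
      NonReflecting (Order.succ κ).ord E ∧ ∀ α ∈ E, α.cof = θ
  powerlt_eq : κ ^< θ = κ

end SetTheory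

section Modules

variable {S : Type u} [Ring S]

/-- A submodule `P` of `M` is pure if `Hom(X, M) → Hom(X, M / P)` is surjective for each finitely
presented module `X`. -/
def IsPure {M : Type u} [AddCommGroup M] [Module S M] (P : Submodule S M) : Prop :=
  ∀ (X : Type u) [AddCommGroup X] [Module S X] [Module.FinitePresentation S X]
    (f : X →ₗ[S] M ⧸ P), ∃ h : X →ₗ[S] M, P.mkQ ∘ₗ h = f

/-- The factor `Q / P` for submodules `P ≤ Q` of a module. -/
abbrev Factor {M : Type u} [AddCommGroup M] [Module S M] (P Q : Submodule S M) : Type u :=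
  Q ⧸ P.submoduleOf Q

/-- For submodules `P ≤ Q ≤ U`, the factor `Q / P` splits in `U / P`, that is, it is a direct
summand of `U / P`. -/
def SplitsIn {M : Type u} [AddCommGroup M] [Module S M] (P Q U : Submodule S M) : Prop :=
  ∃ D : Submodule S (Factor P U),
    IsCompl ((Q.submoduleOf U).map (P.submoduleOf U).mkQ) D

/-- `(F α ∣ α ≤ σ)` is a filtration of the module `M`. Values of `F` beyond `σ` are irrelevant. -/
structure IsFiltration {M : Type u} [AddCommGroup M] [Module S M]
    (σ : Ordinal.{u}) (F : Ordinal.{u} → Submodule S M) : Prop where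
  zero : F 0 = ⊥
  top : F σ = ⊤
  mono : ∀ α β, α < β → β ≤ σ → F α ≤ F β
  limit : ∀ α ≤ σ, Order.IsSuccLimit α → (F α : Set M) = ⋃ β ∈ Set.Iio α, (F β : Set M)

variable (A : CategoryTheory.ObjectProperty (ModuleCat.{u} S))

/-- `(F α ∣ α ≤ σ)` is a pure `A`-filtration of `M`: a filtration with consecutive factors in `A`
and with all its terms pure in `M`. -/
structure IsPureFiltration {M : Type u} [AddCommGroup M] [Module S M]
    (σ : Ordinal.{u}) (F : Ordinal.{u} → Submodule S M) : Prop extends IsFiltration σ F where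
  factor : ∀ α < σ, A (ModuleCat.of S (Factor (F α) (F (α + 1))))
  pure : ∀ α < σ, IsPure (F α)

/-- The class `A` is closed under pure filtrations. -/
def ClosedUnderPureFiltrations : Prop :=
  ∀ (M : ModuleCat.{u} S) (σ : Ordinal.{u}) (F : Ordinal.{u} → Submodule S M),
    IsPureFiltration A σ F → A M

/-- The class `A` is closed under direct summands. -/
def ClosedUnderSummands : Prop :=
  ∀ (M : ModuleCat.{u} S) (P Q : Submodule S M), IsCompl P Q → A M → A (ModuleCat.of S P)

/-- A directed system of modules is `κ`-continuous if each nonempty totally ordered set `J` of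
fewer than `κ` indices has a supremum `s`, and the canonical map from the direct limit of the
subsystem indexed by `J` to `N s` is an isomorphism. -/
def IsContinuousSystem (κ : Cardinal.{u}) {ι : Type u} [PartialOrder ι] [DecidableEq ι]
    (N : ι → Type u)
    [∀ i, AddCommGroup (N i)] [∀ i, Module S (N i)] (g : ∀ i j, i ≤ j → N i →ₗ[S] N j)
    [DirectedSystem N fun i j h => g i j h] : Prop :=
  ∀ J : Set ι, J.Nonempty → IsChain (· ≤ ·) J → #J < κ →
    ∃ (s : ι) (hs : IsLUB J s), Function.Bijective
      (Module.DirectLimit.lift S J (fun j : J => N j) (fun i j h => g i j h)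
        (fun j => g j s (hs.1 j.2))
        (fun _ j h x => DirectedSystem.map_map (f := fun i j h => g i j h) h (hs.1 j.2) x))

end Modules

end EnochsTree

/-! Put `J = θ.ord.ToType`, `K i = N (succ i)`, and choose for each `δ ∈ E` a cofinal ladder of type
`θ` in `δ`. The module lives on the tree of sequences of ordinals below `λ`: along each branch one
takes the span of coherent families `(g i j x)`, cut off at some length. Stage `α` is generated by
the segments whose values are bounded strictly below `α` and by the full ladders of the `δ ∈ E`
below `α`.

Passing from stage `δ ∈ E` to `δ + 1` adds only the ladder of `δ`: since `δ` has cofinality `θ`,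
segments of length less than `θ` with values below `δ` are already bounded below `δ`. Every earlier
branch leaves this ladder at a bounded height, so the new factor consists of coherent families
modulo those of bounded support, which is `varinjlim N` (`exists_eventual_value`). Evaluation along
the ladder is defined on the whole module, hence the factor splits in every later stage
(`treeFiltration_factor`).

For `α < λ`, membership of the stage in `A` needs another filtration. Non-reflection makes the
ladders below `α` free: they pairwise separate by the larger of two assigned heights
(`exists_free`). Segments are added by length, each ladder right after the segments of its assigned
height (`treeModule`). A segment of length `γ` contributes zero or the limit of the `K i` below `γ`,
which is zero or `N γ`; a ladder contributes a direct sum of `K i`'s. The filtration is pure because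
deleting all nodes off finitely many branches retracts the module onto their span
(`exists_branch_retract`). The size bound comes from `κ ^< θ = κ`. -/

namespace EnochsTree

/-! ### Purity from local retractions, and pure filtrations from well-ordered families of
submodules. -/

section PureFiltrations

variable {S : Type u} [Ring S]

/-- Lift `f` on a finite free cover of `X`. The finitely many relations of `X` are sent to finitely
many elements of `U`; subtracting from the lift its composite with a retraction `r` fixing these
elements kills the relations and changes nothing modulo `U`. -/
theorem isPure_of_finset_retract {M : Type u} [AddCommGroup M] [Module S M] (U : Submodule S M)
    (h : ∀ t : Finset M, (t : Set M) ⊆ U →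
      ∃ r : M →ₗ[S] M, (∀ x, r x ∈ U) ∧ ∀ x ∈ t, r x = x) : IsPure U := by
  intro X _ _ hX f
  obtain ⟨s, hs, hK⟩ := hX
  set p : (s →₀ S) →ₗ[S] X := Finsupp.linearCombination S ((↑) : s → X) with hp
  have hpsurj : Function.Surjective p := by
    rw [← LinearMap.range_eq_top, hp, Finsupp.range_linearCombination]
    simpa using hs
  obtain ⟨l, hl⟩ := Module.projective_lifting_property U.mkQ (f ∘ₗ p) U.mkQ_surjective
  have hl' : ∀ y, U.mkQ (l y) = f (p y) := fun y => LinearMap.congr_fun hl y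
  obtain ⟨t, ht⟩ := hK
  classical
  have htU : ((t.image l : Finset M) : Set M) ⊆ U := by
    intro x hx
    simp only [Finset.coe_image, Set.mem_image, Finset.mem_coe] at hx
    obtain ⟨y, hy, rfl⟩ := hx
    have hy' : p y = 0 := by
      have : y ∈ LinearMap.ker p := ht ▸ Submodule.subset_span hy
      simpa using this
    have := hl' y
    rw [hy', map_zero] at this
    simpa using this
  obtain ⟨r, hrU, hr⟩ := h _ htU
  have hker : LinearMap.ker p ≤ LinearMap.ker (l - r ∘ₗ l) := by
    rw [← ht, Submodule.span_le]
    intro y hy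
    have := hr (l y) (Finset.mem_image_of_mem l hy)
    simp [this]
  let e := p.quotKerEquivOfSurjective hpsurj
  refine ⟨(LinearMap.ker p).liftQ (l - r ∘ₗ l) hker ∘ₗ e.symm.toLinearMap, ?_⟩
  ext x
  obtain ⟨y, rfl⟩ := hpsurj x
  have : e.symm (p y) = (LinearMap.ker p).mkQ y := by
    rw [LinearEquiv.symm_apply_eq]
    rfl
  have hz : U.mkQ (r (l y)) = 0 := by simpa using hrU (l y)
  simp only [LinearMap.comp_apply, LinearEquiv.coe_coe, this, Submodule.mkQ_apply,
    Submodule.liftQ_apply, LinearMap.sub_apply]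
  rw [← Submodule.mkQ_apply, map_sub, hz, sub_zero, hl']

/-- Finitely many elements of a sum already lie in a finite subsum, and the retraction onto that
subsum fixes them. -/
theorem isPure_submoduleOf_biSup {P : Type u} [AddCommGroup P] [Module S P] {I : Type*}
    (V : I → Submodule S P)
    (h : ∀ T : Finset I, ∃ r : P →ₗ[S] P, (∀ i, ∀ x ∈ V i, r x ∈ ⨆ j ∈ T, V j) ∧
      ∀ i ∈ T, ∀ x ∈ V i, r x = x) (T : Set I) :
    IsPure ((⨆ i ∈ T, V i).submoduleOf (⨆ i, V i)) := by
  classical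
  have hfin : ∀ x ∈ ⨆ i ∈ T, V i, ∃ T' : Finset I, (T' : Set I) ⊆ T ∧ x ∈ ⨆ i ∈ T', V i := by
    intro x hx
    rw [iSup_subtype' , Submodule.mem_iSup_iff_exists_finset] at hx
    obtain ⟨T', hT'⟩ := hx
    refine ⟨T'.image Subtype.val, by simp, ?_⟩
    refine (iSup₂_le fun i hi => ?_ : (⨆ i ∈ T', V i) ≤ _) hT'
    exact le_iSup₂_of_le (f := fun j (_ : j ∈ T'.image Subtype.val) => V j) (i : I)
      (Finset.mem_image_of_mem _ hi) le_rfl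
  have hmono : ∀ {T₁ T₂ : Finset I}, T₁ ⊆ T₂ → (⨆ i ∈ T₁, V i) ≤ ⨆ i ∈ T₂, V i :=
    fun hT => biSup_mono fun i hi => hT hi
  apply isPure_of_finset_retract
  intro t ht
  have : ∃ T' : Finset I, (T' : Set I) ⊆ T ∧ ∀ x ∈ t, (x : P) ∈ ⨆ i ∈ T', V i := by
    have h1 : ∀ x ∈ t, ∃ T' : Finset I, (T' : Set I) ⊆ T ∧ (x : P) ∈ ⨆ i ∈ T', V i :=
      fun x hx => hfin _ (ht hx)
    choose! T' hT' hx using h1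
    refine ⟨t.biUnion T', by simpa using hT', fun x hxt => ?_⟩
    exact hmono (Finset.subset_biUnion_of_mem T' hxt) (hx x hxt)
  obtain ⟨T', hT', hx⟩ := this
  obtain ⟨r, hr1, hr2⟩ := h T'
  have hle : (⨆ i ∈ T', V i) ≤ ⨆ i ∈ T, V i := biSup_mono fun i hi => hT' hi
  have hr1' : ∀ x ∈ ⨆ i, V i, r x ∈ ⨆ j ∈ T', V j := by
    intro x hx
    have : (⨆ i, V i) ≤ (⨆ j ∈ T', V j).comap r := iSup_le fun i x hx => hr1 i x hx
    exact this hx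
  have hr2' : ∀ x ∈ ⨆ i ∈ T', V i, r x = x := by
    intro x hx
    have : (⨆ i ∈ T', V i) ≤ LinearMap.ker (r - LinearMap.id) :=
      iSup₂_le fun i hi x hx => by simp [hr2 i hi x hx]
    simpa [sub_eq_zero] using this hx
  have hle' : (⨆ i ∈ T, V i) ≤ ⨆ i, V i := iSup₂_le fun i _ => le_iSup V i
  refine ⟨r.restrict fun x hx => hle' (hle (hr1' x hx)), fun x => ?_, fun x hxt => ?_⟩
  · exact hle (hr1' x x.2)
  · ext
    exact hr2' _ (hx x hxt)

/-- The second isomorphism theorem, with the left-hand side given by a surjection. -/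
theorem nonempty_factor_equiv {P : Type u} [AddCommGroup P] [Module S P] {U V Q : Submodule S P}
    (hQ : Q = V ⊔ U) {Y : Type u} [AddCommGroup Y] [Module S Y] (f : V →ₗ[S] Y)
    (hf : Function.Surjective f) (hker : ∀ x, f x = 0 ↔ (x : P) ∈ U) :
    Nonempty (Y ≃ₗ[S] Factor U Q) := by
  subst hQ
  have hk : LinearMap.ker f = (V ⊓ U).comap V.subtype := by
    ext x
    simp [hker]
  exact ⟨(f.quotKerEquivOfSurjective hf).symm ≪≫ₗ Submodule.quotEquivOfEq _ _ hk ≪≫ₗ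
    LinearMap.quotientInfEquivSupQuotient V U⟩

theorem nonempty_factor_submoduleOf_equiv {P : Type u} [AddCommGroup P] [Module S P]
    {U Q M : Submodule S P} (hQ : Q ≤ M) :
    Nonempty (Factor U Q ≃ₗ[S] Factor (U.submoduleOf M) (Q.submoduleOf M)) := by
  let e := Submodule.submoduleOfEquivOfLe hQ
  refine ⟨(Submodule.Quotient.equiv _ _ e ?_).symm⟩
  apply le_antisymm
  · rintro _ ⟨y, hy, rfl⟩
    exact hy
  · intro x hx
    exact ⟨e.symm x, hx, e.apply_symm_apply x⟩

variable {A : CategoryTheory.ObjectProperty (ModuleCat.{u} S)}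

theorem mem_of_equiv [A.IsClosedUnderIsomorphisms] {Y Z : Type u} [AddCommGroup Y] [Module S Y]
    [AddCommGroup Z] [Module S Z] (e : Y ≃ₗ[S] Z) (h : A (ModuleCat.of S Y)) :
    A (ModuleCat.of S Z) :=
  A.prop_of_iso e.toModuleIso h

theorem ClosedUnderPureFiltrations.punit (hA : ClosedUnderPureFiltrations A) :
    A (ModuleCat.of S PUnit.{u + 1}) := by
  refine hA _ 0 (fun _ => ⊥) ⟨⟨rfl, Subsingleton.elim _ _, fun _ _ _ _ => le_rfl, ?_⟩, ?_, ?_⟩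
  · intro α hα hl
    rw [nonpos_iff_eq_zero] at hα
    exact absurd (hα ▸ hl.bot_lt) (by simp)
  · intro α hα
    exact absurd hα (not_lt_zero)
  · intro α hα
    exact absurd hα (not_lt_zero)

/-- The partial sums along the well-order form the filtration. The step at `i` adjoins `V i`, so its
factor is `V i` modulo its intersection with the earlier sum, which `f` identifies with `Y`. -/
theorem ClosedUnderPureFiltrations.of_wellOrder [A.IsClosedUnderIsomorphisms]
    (hA : ClosedUnderPureFiltrations A)
    {P : Type u} [AddCommGroup P] [Module S P] {I : Type u} [LinearOrder I] [WellFoundedLT I]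
    (V : I → Submodule S P)
    (hfac : ∀ i, ∃ (Y : ModuleCat.{u} S) (f : V i →ₗ[S] Y), A Y ∧ Function.Surjective f ∧
      ∀ x, f x = 0 ↔ (x : P) ∈ ⨆ j ∈ Set.Iio i, V j)
    (hp : ∀ T : Set I, IsPure ((⨆ i ∈ T, V i).submoduleOf (⨆ i, V i))) :
    A (ModuleCat.of S ↥(⨆ i, V i)) := by
  let rk : I → Ordinal.{u} := Ordinal.typein (α := I) (· < ·)
  have hrk : ∀ i j, rk i < rk j ↔ i < j := fun i j => Ordinal.typein_lt_typein (α := I) (· < ·)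
  let σ : Ordinal.{u} := Ordinal.type (α := I) (· < ·)
  have hσ : ∀ α < σ, ∃ i, rk i = α := fun α hα =>
    Ordinal.mem_range_typein_iff (α := I) (· < ·) |>.2 hα
  let B : Ordinal.{u} → Submodule S P := fun α => ⨆ i ∈ {i | rk i < α}, V i
  have hBM : ∀ α, B α ≤ ⨆ i, V i := fun α => iSup₂_le fun i _ => le_iSup V i
  have hBmono : Monotone B := fun α β h => biSup_mono fun i (hi : rk i < α) => lt_of_lt_of_le hi h
  have hB : ∀ i, B (rk i) = ⨆ j ∈ Set.Iio i, V j := by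
    intro i
    have : {j | rk j < rk i} = Set.Iio i := by ext j; exact hrk j i
    simp only [B, this]
  have hBs : ∀ i, B (rk i + 1) = V i ⊔ B (rk i) := by
    intro i
    apply le_antisymm
    · refine iSup₂_le fun j hj => ?_
      rcases (Order.lt_add_one_iff.1 (show rk j < rk i + 1 from hj)).lt_or_eq with h | h
      · exact le_sup_of_le_right (le_iSup₂_of_le (f := fun j (_ : j ∈ {j | rk j < rk i}) => V j)
          j h le_rfl)
      · have : j = i := Ordinal.typein_injective (α := I) (· < ·) h
        exact this ▸ le_sup_left
    · refine sup_le (le_iSup₂_of_le (f := fun j (_ : j ∈ {j | rk j < rk i + 1}) => V j) i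
        (show rk i < rk i + 1 from Order.lt_add_one_iff.2 le_rfl) le_rfl)
        (hBmono (Order.lt_add_one_iff.2 le_rfl).le)
  refine hA _ σ (fun α => (B α).submoduleOf (⨆ i, V i)) ⟨⟨?_, ?_, ?_, ?_⟩, ?_, ?_⟩
  · have : B 0 = ⊥ := by
      simp [B]
    simp [this, Submodule.submoduleOf]
  · rw [Submodule.submoduleOf_eq_top]
    exact iSup_le fun i => le_iSup₂_of_le (f := fun j (_ : j ∈ {j | rk j < σ}) => V j) i
        (Ordinal.typein_lt_type _ i) le_rfl
  · intro α β h _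
    exact Submodule.comap_mono (hBmono h.le)
  · intro α _ hα
    have : Nonempty (Set.Iio α) := ⟨⟨0, hα.bot_lt⟩⟩
    have hBα : B α = ⨆ β : Set.Iio α, B β := by
      apply le_antisymm
      · refine iSup₂_le fun i (hi : rk i < α) => ?_
        refine le_iSup_of_le ⟨rk i + 1, hα.add_one_lt hi⟩ ?_
        rw [hBs]
        exact le_sup_left
      · exact iSup_le fun β => hBmono β.2.le
    have hmem : ∀ x, x ∈ B α ↔ ∃ β < α, x ∈ B β := fun x => by
      rw [hBα, Submodule.mem_iSup_of_directed (fun β : Set.Iio α => B β)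
        (hBmono.comp (Subtype.mono_coe _)).directed_le]
      simp
    ext x
    simp only [Set.mem_iUnion, Set.mem_Iio, exists_prop]
    exact hmem x
  · intro α hα
    obtain ⟨i, rfl⟩ := hσ α hα
    obtain ⟨Y, f, hY, hf, hk⟩ := hfac i
    obtain ⟨e⟩ := nonempty_factor_equiv (hBs i) f hf (by rw [hB]; exact hk)
    obtain ⟨e'⟩ := nonempty_factor_submoduleOf_equiv (U := B (rk i)) (hBM (rk i + 1))
    exact mem_of_equiv (e ≪≫ₗ e') hY
  · intro α _
    exact hp _

/-- Order lexicographically by `key`, breaking ties by an arbitrary well-order. -/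
theorem exists_linearOrder_monotone {I Λ : Type*} [LinearOrder Λ] [WellFoundedLT Λ]
    (key : I → Λ) :
    ∃ _ : LinearOrder I, WellFoundedLT I ∧ ∀ i j : I, i < j → key i ≤ key j := by
  obtain ⟨w, _⟩ := exists_wellFoundedLT I
  let k : I → Λ ×ₗ I := fun i => toLex (key i, i)
  have hk : Function.Injective k := fun i j h => (Prod.ext_iff.1 (toLex.injective h)).2
  have hlt : ∀ i j, k i < k j → key i ≤ key j := fun i j h => by
    rw [Prod.Lex.toLex_lt_toLex] at h
    exact h.elim le_of_lt fun h => h.1.le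
  clear_value k
  have hwf : WellFounded fun i j => k i < k j := InvImage.wf k wellFounded_lt
  exact ⟨LinearOrder.lift' k hk, ⟨hwf⟩, hlt⟩

/-- Filtrations along a well-founded key: the indices with equal keys may be added in any order. -/
theorem ClosedUnderPureFiltrations.of_key [A.IsClosedUnderIsomorphisms]
    (hA : ClosedUnderPureFiltrations A)
    {P : Type u} [AddCommGroup P] [Module S P] {I : Type u} {Λ : Type*} [LinearOrder Λ]
    [WellFoundedLT Λ] (key : I → Λ) (V : I → Submodule S P)
    (hfac : ∀ (i : I) (T : Set I), (∀ j, key j < key i → j ∈ T) →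
      (∀ j ∈ T, key j ≤ key i ∧ j ≠ i) →
      ∃ (Y : ModuleCat.{u} S) (f : V i →ₗ[S] Y), A Y ∧ Function.Surjective f ∧
      ∀ x, f x = 0 ↔ (x : P) ∈ ⨆ j ∈ T, V j)
    (hp : ∀ T : Set I, IsPure ((⨆ i ∈ T, V i).submoduleOf (⨆ i, V i))) :
    A (ModuleCat.of S ↥(⨆ i, V i)) := by
  obtain ⟨_, _, ho⟩ := exists_linearOrder_monotone key
  refine hA.of_wellOrder V
    (fun i => hfac i _ (fun j hj => ?_) fun j hj => ⟨ho j i hj, ne_of_lt hj⟩) hp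
  by_contra h
  exact hj.not_ge ((not_lt.1 h).eq_or_lt.elim (fun h => h ▸ le_rfl) (ho i j))

theorem ClosedUnderPureFiltrations.directSum [A.IsClosedUnderIsomorphisms]
    (hA : ClosedUnderPureFiltrations A) {I : Type u} [DecidableEq I] (N : I → Type u)
    [∀ i, AddCommGroup (N i)] [∀ i, Module S (N i)] (hN : ∀ i, A (ModuleCat.of S (N i))) :
    A (ModuleCat.of S (DirectSum I N)) := by
  classical
  let V : I → Submodule S (DirectSum I N) := fun i => LinearMap.range (DirectSum.lof S I N i)
  have htop : (⨆ i, V i) = ⊤ := DFinsupp.iSup_range_lsingle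
  suffices A (ModuleCat.of S ↥(⨆ i, V i)) from
    mem_of_equiv (LinearEquiv.ofTop _ htop) this
  -- Independent summands may be added in any order, so a constant key suffices.
  refine hA.of_key (fun _ => (0 : ℕ)) V (fun i T _ hT => ?_) fun T => ?_
  · refine ⟨ModuleCat.of S (N i), DirectSum.component S I N i ∘ₗ (V i).subtype, hN i, fun y =>
      ⟨⟨DirectSum.lof S I N i y, y, rfl⟩, ?_⟩, ?_⟩
    · exact DirectSum.component.lof_self S i y
    · rintro ⟨_, y, rfl⟩
      have hy : DirectSum.component S I N i (DirectSum.lof S I N i y) = y :=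
        DirectSum.component.lof_self S i y
      constructor
      · intro h
        have h' : y = 0 := hy.symm.trans h
        simp [h']
      · intro h
        have : (⨆ j ∈ T, V j) ≤ LinearMap.ker (DirectSum.component S I N i) := by
          refine iSup₂_le fun j hj => ?_
          rintro _ ⟨z, rfl⟩
          rw [LinearMap.mem_ker, DirectSum.component.of, dif_neg (hT j hj).2]
        exact this h
  · refine isPure_submoduleOf_biSup V (fun T => ⟨DFinsupp.filterLinearMap S N (· ∈ T), ?_, ?_⟩) T
    · rintro i _ ⟨y, rfl⟩
      by_cases hi : i ∈ T
      · have : DFinsupp.filterLinearMap S N (· ∈ T) (DirectSum.lof S I N i y) =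
            DirectSum.lof S I N i y := DFinsupp.filter_single_pos (p := (· ∈ T)) i y hi
        rw [this]
        exact Submodule.mem_iSup_of_mem i (Submodule.mem_iSup_of_mem hi ⟨y, rfl⟩)
      · have : DFinsupp.filterLinearMap S N (· ∈ T) (DirectSum.lof S I N i y) = 0 :=
          DFinsupp.filter_single_neg (p := (· ∈ T)) i y hi
        rw [this]
        exact zero_mem _
    · rintro i hi _ ⟨y, rfl⟩
      exact DFinsupp.filter_single_pos (p := (· ∈ T)) i y hi

end PureFiltrations

/-! ### Piecewise coherent families along a single branch. -/

section Segments

variable {S : Type u} [Ring S] {J : Type u} [LinearOrder J] {K : J → Type u}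
  [∀ i, AddCommGroup (K i)] [∀ i, Module S (K i)] (g : ∀ i j, i ≤ j → K i →ₗ[S] K j)

/-- The coherent family `(g i j x)` for `i ≤ j < γ`, extended by zero. -/
noncomputable def seg (γ : WithTop J) (i : J) : K i →ₗ[S] ∀ j, K j :=
  LinearMap.pi fun j => if h : i ≤ j ∧ (j : WithTop J) < γ then g i j h.1 else 0

theorem seg_apply_of_lt {γ : WithTop J} {i j : J} (hij : i ≤ j) (hj : (j : WithTop J) < γ) (x : K i) :
    seg g γ i x j = g i j hij x := by
  simp [seg, hij, hj]

theorem seg_apply_of_not {γ : WithTop J} {i j : J} (h : ¬ (i ≤ j ∧ (j : WithTop J) < γ)) (x : K i) :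
    seg g γ i x j = 0 := by
  simp only [seg, LinearMap.pi_apply, dif_neg h, LinearMap.zero_apply]

theorem seg_eq_zero {γ : WithTop J} {i : J} (h : γ ≤ i) (x : K i) : seg g γ i x = 0 := by
  ext j
  refine seg_apply_of_not g (fun h' => ?_) x
  exact absurd (h'.2.trans_le (h.trans (WithTop.coe_le_coe.2 h'.1))) (lt_irrefl _)

variable (S K) in
/-- The restriction of a family to the indices below `γ`, extended by zero. -/
noncomputable def trunc (γ : WithTop J) : (∀ j, K j) →ₗ[S] ∀ j, K j :=
  LinearMap.pi fun j => if (j : WithTop J) < γ then LinearMap.proj j else 0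

theorem trunc_apply (γ : WithTop J) (h : ∀ j, K j) (j : J) :
    trunc S K γ h j = if (j : WithTop J) < γ then h j else 0 := by
  simp only [trunc, LinearMap.pi_apply]
  split_ifs <;> rfl

@[simp]
theorem trunc_top (h : ∀ j, K j) : trunc S K ⊤ h = h := by
  ext j
  simp [trunc_apply, WithTop.coe_lt_top]

theorem trunc_seg (γ γ' : WithTop J) (i : J) (x : K i) :
    trunc S K γ (seg g γ' i x) = seg g (min γ γ') i x := by
  ext j
  rw [trunc_apply]
  by_cases h : i ≤ j ∧ (j : WithTop J) < γ'
  · split_ifs with h'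
    · rw [seg_apply_of_lt g h.1 h.2, seg_apply_of_lt g h.1 (lt_min h' h.2)]
    · rw [seg_apply_of_not g (fun h'' => h' (h''.2.trans_le (min_le_left _ _)))]
  · rw [seg_apply_of_not g h,
      seg_apply_of_not g (fun h'' => h ⟨h''.1, h''.2.trans_le (min_le_right _ _)⟩), ite_self]

/-- The piecewise coherent families with support below `γ`. -/
def segSpan (γ : WithTop J) : Submodule S (∀ j, K j) :=
  Submodule.span S {h | ∃ γ' ≤ γ, ∃ i x, h = seg g γ' i x}

/-- The piecewise coherent families with support bounded below `γ`. -/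
def segSpanLT (γ : WithTop J) : Submodule S (∀ j, K j) :=
  Submodule.span S {h | ∃ γ' < γ, ∃ i x, h = seg g γ' i x}

theorem seg_mem_segSpan {γ γ' : WithTop J} (h : γ' ≤ γ) (i : J) (x : K i) :
    seg g γ' i x ∈ segSpan g γ :=
  Submodule.subset_span ⟨γ', h, i, x, rfl⟩

theorem seg_mem_segSpanLT {γ γ' : WithTop J} (h : γ' < γ) (i : J) (x : K i) :
    seg g γ' i x ∈ segSpanLT g γ :=
  Submodule.subset_span ⟨γ', h, i, x, rfl⟩

theorem segSpan_le_iff {γ : WithTop J} {W : Submodule S (∀ j, K j)} :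
    segSpan g γ ≤ W ↔ ∀ γ' ≤ γ, ∀ i x, seg g γ' i x ∈ W := by
  rw [segSpan, Submodule.span_le]
  exact ⟨fun h γ' hγ' i x => h ⟨γ', hγ', i, x, rfl⟩, fun h => by
    rintro _ ⟨γ', hγ', i, x, rfl⟩
    exact h γ' hγ' i x⟩

theorem segSpanLT_le_iff {γ : WithTop J} {W : Submodule S (∀ j, K j)} :
    segSpanLT g γ ≤ W ↔ ∀ γ' < γ, ∀ i x, seg g γ' i x ∈ W := by
  rw [segSpanLT, Submodule.span_le]
  exact ⟨fun h γ' hγ' i x => h ⟨γ', hγ', i, x, rfl⟩, fun h => by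
    rintro _ ⟨γ', hγ', i, x, rfl⟩
    exact h γ' hγ' i x⟩

theorem segSpan_mono {γ γ' : WithTop J} (h : γ ≤ γ') : segSpan g γ ≤ segSpan g γ' :=
  (segSpan_le_iff g).2 fun _ hδ i x => seg_mem_segSpan g (hδ.trans h) i x

theorem segSpan_le_segSpanLT {γ γ' : WithTop J} (h : γ < γ') : segSpan g γ ≤ segSpanLT g γ' :=
  (segSpan_le_iff g).2 fun _ hδ i x => seg_mem_segSpanLT g (hδ.trans_lt h) i x

theorem segSpanLT_le_of_forall {γ : WithTop J} {W : Submodule S (∀ j, K j)}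
    (h : ∀ γ' < γ, segSpan g γ' ≤ W) : segSpanLT g γ ≤ W :=
  (segSpanLT_le_iff g).2 fun γ' hγ' i x => h γ' hγ' (seg_mem_segSpan g le_rfl i x)

theorem trunc_mem_segSpan {γ γ' : WithTop J} {h : ∀ j, K j} (hh : h ∈ segSpan g γ') :
    trunc S K γ h ∈ segSpan g (min γ γ') := by
  have : segSpan g γ' ≤ (segSpan g (min γ γ')).comap (trunc S K γ) := by
    rw [segSpan_le_iff]
    intro δ hδ i x
    rw [Submodule.mem_comap, trunc_seg]
    exact seg_mem_segSpan g (min_le_min_left γ hδ) i x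
  exact this hh

theorem trunc_eq_self {γ γ' : WithTop J} (hγ : γ' ≤ γ) {h : ∀ j, K j} (hh : h ∈ segSpan g γ') :
    trunc S K γ h = h := by
  have : segSpan g γ' ≤ LinearMap.ker (trunc S K γ - LinearMap.id) := by
    rw [segSpan_le_iff]
    intro δ hδ i x
    rw [LinearMap.mem_ker, LinearMap.sub_apply, trunc_seg, min_eq_right (hδ.trans hγ)]
    exact sub_self _
  simpa [sub_eq_zero] using this hh

theorem mem_segSpan_of_isMin {γ : J} (hγ : IsMin γ) {h : ∀ j, K j}
    (hh : h ∈ segSpan g (γ : WithTop J)) : h = 0 := by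
  rw [← trunc_eq_self g le_rfl hh]
  ext j
  rw [trunc_apply, if_neg fun hj => hγ.not_lt (WithTop.coe_lt_coe.1 hj)]
  rfl

theorem eventually_zero_of_mem_segSpanLT {γ : WithTop J} {h : ∀ j, K j}
    (hγ : ∃ i : J, (i : WithTop J) < γ)
    (hh : h ∈ segSpanLT g γ) :
    ∃ i : J, (i : WithTop J) < γ ∧ ∀ j, i ≤ j → h j = 0 := by
  induction hh using Submodule.span_induction with
  | mem h hh =>
    obtain ⟨γ', hγ', i, x, rfl⟩ := hh
    lift γ' to J using (hγ'.trans_le le_top).ne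
    exact ⟨γ', hγ', fun j hj => seg_apply_of_not g (fun h => (WithTop.coe_lt_coe.1 h.2).not_ge hj) x⟩
  | zero => exact hγ.imp fun i hi => ⟨hi, fun _ _ => rfl⟩
  | add a b _ _ ha hb =>
    obtain ⟨i, hi, hi'⟩ := ha
    obtain ⟨j, hj, hj'⟩ := hb
    have hk : ((max i j : J) : WithTop J) < γ := by
      rcases max_choice i j with h | h <;> rwa [h]
    refine ⟨_, hk, fun k hk => ?_⟩
    rw [Pi.add_apply, hi' k ((le_max_left _ _).trans hk), hj' k ((le_max_right _ _).trans hk),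
      add_zero]
  | smul c a _ ha =>
    obtain ⟨i, hi, hi'⟩ := ha
    exact ⟨i, hi, fun j hj => by rw [Pi.smul_apply, hi' j hj, smul_zero]⟩

variable [DirectedSystem K fun i j h => g i j h]

/-- Coherence makes the part of a segment past `j` again a segment, so starting points can be moved
up at the cost of a shorter segment. -/
theorem seg_split {γ : WithTop J} {i j : J} (hij : i ≤ j) (hj : (j : WithTop J) ≤ γ) (x : K i) :
    seg g γ i x = seg g j i x + seg g γ j (g i j hij x) := by
  ext k
  rw [Pi.add_apply]
  by_cases hik : i ≤ k
  · by_cases hkj : k < j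
    · have hk : (k : WithTop J) < j := WithTop.coe_lt_coe.2 hkj
      rw [seg_apply_of_lt g hik (hk.trans_le hj), seg_apply_of_lt g hik hk,
        seg_apply_of_not g (fun h => hkj.not_ge h.1), add_zero]
    · have hk : ¬ (k : WithTop J) < j := fun h => hkj (WithTop.coe_lt_coe.1 h)
      rw [seg_apply_of_not (γ := (j : WithTop J)) g (fun h => hk h.2), zero_add]
      by_cases hkγ : (k : WithTop J) < γ
      · rw [seg_apply_of_lt g hik hkγ, seg_apply_of_lt g (not_lt.1 hkj) hkγ]
        exact (DirectedSystem.map_map (f := fun i j h => g i j h) hij (not_lt.1 hkj) x).symm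
      · rw [seg_apply_of_not g (fun h => hkγ h.2), seg_apply_of_not g (fun h => hkγ h.2)]
  · rw [seg_apply_of_not g (fun h => hik h.1), seg_apply_of_not g (fun h => hik h.1),
      seg_apply_of_not g (fun h => hik (hij.trans h.1)), add_zero]

/-- Modulo `segSpanLT g γ` only segments reaching `γ` survive, and `seg_split` moves any two of them
to a common starting point, where they add up to one. -/
theorem exists_sub_seg_mem_segSpanLT {γ : WithTop J} (hγ : ∃ i : J, (i : WithTop J) < γ)
    {h : ∀ j, K j} (hh : h ∈ segSpan g γ) :
    ∃ i : J, (i : WithTop J) < γ ∧ ∃ x, h - seg g γ i x ∈ segSpanLT g γ := by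
  obtain ⟨i₀, hi₀⟩ := hγ
  have key : ∀ i j : J, i ≤ j → (j : WithTop J) < γ → ∀ h x, h - seg g γ i x ∈ segSpanLT g γ →
      ∃ y, h - seg g γ j y ∈ segSpanLT g γ := by
    intro i j hij hj h x hx
    refine ⟨g i j hij x, ?_⟩
    rw [seg_split g hij hj.le] at hx
    have := add_mem hx (seg_mem_segSpanLT g hj i x)
    convert this using 1
    abel
  induction hh using Submodule.span_induction with
  | mem h hh =>
    obtain ⟨γ', hγ', i, x, rfl⟩ := hh
    rcases hγ'.lt_or_eq with h | rfl
    · exact ⟨i₀, hi₀, 0, by simpa using seg_mem_segSpanLT g h i x⟩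
    · by_cases hi : (i : WithTop J) < γ'
      · exact ⟨i, hi, x, by simp⟩
      · exact ⟨i₀, hi₀, 0, by simp [seg_eq_zero g (not_lt.1 hi)]⟩
  | zero => exact ⟨i₀, hi₀, 0, by simp⟩
  | add a b _ _ ha hb =>
    obtain ⟨i, hi, x, hx⟩ := ha
    obtain ⟨j, hj, y, hy⟩ := hb
    have hk : ((max i j : J) : WithTop J) < γ := by
      rcases max_choice i j with h | h <;> rwa [h]
    obtain ⟨x', hx'⟩ := key i _ (le_max_left i j) hk a x hx
    obtain ⟨y', hy'⟩ := key j _ (le_max_right i j) hk b y hy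
    refine ⟨_, hk, x' + y', ?_⟩
    have := add_mem hx' hy'
    rw [map_add]
    convert this using 1
    abel
  | smul c a _ ha =>
    obtain ⟨i, hi, x, hx⟩ := ha
    refine ⟨i, hi, c • x, ?_⟩
    rw [map_smul, ← smul_sub]
    exact Submodule.smul_mem _ c hx

/-- If `Y` is the direct limit of the `K i` with `i < γ`, then the families in `segSpan g γ`
have an eventual value in `Y`, which induces an isomorphism `segSpan g γ ⧸ segSpanLT g γ ≃ Y`. -/
theorem exists_eventual_value {γ : WithTop J} (hγ : ∃ i : J, (i : WithTop J) < γ)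
    {Y : Type u} [AddCommGroup Y] [Module S Y] (u : ∀ i : J, (i : WithTop J) < γ → K i →ₗ[S] Y)
    (hu : ∀ (i j : J) (hij : i ≤ j) (hj : (j : WithTop J) < γ) x,
      u j hj (g i j hij x) = u i ((WithTop.coe_le_coe.2 hij).trans_lt hj) x)
    (hsurj : ∀ y, ∃ i hi x, u i hi x = y)
    (hker : ∀ i hi x, u i hi x = 0 → ∃ j, ∃ hij : i ≤ j, (j : WithTop J) < γ ∧ g i j hij x = 0) :
    ∃ φ : segSpan g γ →ₗ[S] Y, Function.Surjective φ ∧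
      ∀ h, φ h = 0 ↔ (h : ∀ j, K j) ∈ segSpanLT g γ := by
  -- `R h y` says that `y` is the eventual value of `h` in `Y`; as `J` is linear, such a value is
  -- unique and additive.
  let R : (∀ j, K j) → Y → Prop := fun h y =>
    ∃ i : J, (i : WithTop J) < γ ∧ ∀ (j : J) (hj : (j : WithTop J) < γ), i ≤ j → u j hj (h j) = y
  have hR : ∀ {h h' y y'}, R h y → R h' y' → ∃ i : J, ∃ hi : (i : WithTop J) < γ,
      u i hi (h i) = y ∧ u i hi (h' i) = y' := by
    rintro h h' y y' ⟨i, hi, hi'⟩ ⟨j, hj, hj'⟩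
    have hk : ((max i j : J) : WithTop J) < γ := by
      rcases max_choice i j with h | h <;> rwa [h]
    exact ⟨_, hk, hi' _ hk (le_max_left _ _), hj' _ hk (le_max_right _ _)⟩
  have huniq : ∀ {h y y'}, R h y → R h y' → y = y' := by
    intro h y y' h₁ h₂
    obtain ⟨i, hi, rfl, rfl⟩ := hR h₁ h₂
    rfl
  have hadd : ∀ {h h' y y'}, R h y → R h' y' → R (h + h') (y + y') := by
    rintro h h' y y' ⟨i, hi, hi'⟩ ⟨j, hj, hj'⟩
    have hk : ((max i j : J) : WithTop J) < γ := by
      rcases max_choice i j with h | h <;> rwa [h]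
    refine ⟨_, hk, fun k hk hk' => ?_⟩
    rw [Pi.add_apply, map_add, hi' k hk ((le_max_left _ _).trans hk'),
      hj' k hk ((le_max_right _ _).trans hk')]
  have hsmul : ∀ {h y} (c : S), R h y → R (c • h) (c • y) := by
    rintro h y c ⟨i, hi, hi'⟩
    refine ⟨i, hi, fun k hk hk' => ?_⟩
    rw [Pi.smul_apply, map_smul, hi' k hk hk']
  have hseg : ∀ i hi x, R (seg g γ i x) (u i hi x) := fun i hi x =>
    ⟨i, hi, fun j hj hij => by rw [seg_apply_of_lt g hij hj, hu]⟩
  have hLT : ∀ {h}, h ∈ segSpanLT g γ → R h 0 := by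
    intro h hh
    obtain ⟨i, hi, hi'⟩ := eventually_zero_of_mem_segSpanLT g hγ hh
    exact ⟨i, hi, fun j hj hij => by rw [hi' j hij, map_zero]⟩
  have hdec : ∀ h ∈ segSpan g γ, ∃ i : J, ∃ hi : (i : WithTop J) < γ, ∃ x, R h (u i hi x) ∧
      h - seg g γ i x ∈ segSpanLT g γ := by
    intro h hh
    obtain ⟨i, hi, x, hx⟩ := exists_sub_seg_mem_segSpanLT g hγ hh
    refine ⟨i, hi, x, ?_, hx⟩
    simpa using hadd (hLT hx) (hseg i hi x)
  have hex : ∀ h : segSpan g γ, ∃ y, R h y := fun h => by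
    obtain ⟨i, hi, x, hx, _⟩ := hdec h h.2
    exact ⟨_, hx⟩
  choose φ hφ using hex
  refine ⟨⟨⟨φ, fun a b => ?_⟩, fun c a => ?_⟩, fun y => ?_, fun h => ?_⟩
  · exact huniq (hφ _) (hadd (hφ a) (hφ b))
  · exact huniq (hφ _) (hsmul c (hφ a))
  · obtain ⟨i, hi, x, rfl⟩ := hsurj y
    exact ⟨⟨_, seg_mem_segSpan g le_rfl i x⟩, huniq (hφ _) (hseg i hi x)⟩
  · change φ h = 0 ↔ _
    refine ⟨fun h0 => ?_, fun hh => huniq (hφ h) (hLT hh)⟩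
    obtain ⟨i, hi, x, hx, hx'⟩ := hdec h h.2
    obtain ⟨j, hij, hj, hj'⟩ := hker i hi x ((huniq hx (hφ h)).trans h0)
    -- Once `x` dies at `j`, its segment up to `γ` coincides with the one stopping at `j`.
    rw [seg_split g hij hj.le, hj', map_zero, add_zero] at hx'
    simpa using add_mem hx' (seg_mem_segSpanLT g hj i x)

/-- Removing the part below `γ` leaves a combination of full segments starting at indices `i ≥ γ`,
because a truncated segment is a difference of two full ones. Full segments with distinct starting
points are independent: the first nonzero coordinate of the sum recovers the first coefficient. -/
theorem exists_equiv_directSum [WellFoundedLT J] (γ : J) :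
    ∃ φ : segSpan g ⊤ →ₗ[S] DirectSum (Set.Ici γ) (fun i => K i), Function.Surjective φ ∧
      ∀ h, φ h = 0 ↔ (h : ∀ j, K j) ∈ segSpan g γ := by
  classical
  let T : DirectSum (Set.Ici γ) (fun i => K i) →ₗ[S] ∀ j, K j :=
    DirectSum.toModule S (Set.Ici γ) (∀ j, K j) fun i => seg g ⊤ i
  have hTlof : ∀ i x, T (DirectSum.lof S (Set.Ici γ) (fun i => K i) i x) = seg g ⊤ i x :=
    fun i x => DirectSum.toModule_lof S (φ := fun i : Set.Ici γ => seg g ⊤ i) i x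
  have hTsum : ∀ x, T x = ∑ i ∈ DFinsupp.support x, seg g ⊤ i (x i) := fun x =>
    DFinsupp.sumAddHom_apply (fun i : Set.Ici γ => (seg g ⊤ i).toAddMonoidHom) x
  have hTinj : Function.Injective T := by
    rw [injective_iff_map_eq_zero]
    intro x hx
    suffices ∀ i, x i = 0 from DFinsupp.ext this
    intro i
    induction i using WellFoundedLT.induction with
    | ind i ih =>
      have h := congrFun (hTsum x) i
      rw [hx, Finset.sum_apply, Finset.sum_eq_single i] at h
      · rw [seg_apply_of_lt g le_rfl (WithTop.coe_lt_top _),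
          DirectedSystem.map_self (f := fun i j h => g i j h)] at h
        exact h.symm
      · intro k hk hki
        refine seg_apply_of_not g (fun h' => ?_) _
        have : k < i := lt_of_le_of_ne h'.1 hki
        exact (DFinsupp.mem_support_iff.1 hk) (ih k this)
      · intro hi
        rw [DFinsupp.notMem_support_iff] at hi
        rw [show x i = 0 from hi, map_zero]
        rfl
  have hsegT : ∀ (i : J) x, γ ≤ i → seg g ⊤ i x ∈ LinearMap.range T := fun i x hi =>
    ⟨DirectSum.lof S (Set.Ici γ) (fun i => K i) ⟨i, hi⟩ x, hTlof ⟨i, hi⟩ x⟩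
  have hsegT' : ∀ (i : J) x δ, γ ≤ i → seg g δ i x ∈ LinearMap.range T := by
    intro i x δ hi
    induction δ using WithTop.recTopCoe with
    | top => exact hsegT i x hi
    | coe δ =>
      rcases le_total δ i with h | h
      · rw [seg_eq_zero g (WithTop.coe_le_coe.2 h)]
        exact zero_mem _
      · have := sub_mem (hsegT i x hi) (hsegT δ (g i δ h x) (hi.trans h))
        rwa [seg_split g h le_top, add_sub_cancel_right] at this
  have hmem : segSpan g ⊤ ≤ (LinearMap.range T).comap (LinearMap.id - trunc S K γ) := by
    rw [segSpan_le_iff]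
    intro δ _ i x
    rw [Submodule.mem_comap, LinearMap.sub_apply, trunc_seg, LinearMap.id_apply]
    rcases le_total δ γ with h | h
    · rw [min_eq_right h, sub_self]
      exact zero_mem _
    · rw [min_eq_left h]
      rcases le_total γ i with h' | h'
      · exact sub_mem (hsegT' i x δ h') (hsegT' i x γ h')
      · rw [seg_split g h' h, add_sub_cancel_left]
        exact hsegT' _ _ _ le_rfl
  have hTrange : LinearMap.range T ≤ segSpan g ⊤ ⊓ LinearMap.ker (trunc S K γ) := by
    rintro _ ⟨x, rfl⟩
    rw [hTsum]
    refine sum_mem fun i _ => ⟨seg_mem_segSpan g le_rfl _ _, ?_⟩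
    rw [SetLike.mem_coe, LinearMap.mem_ker, trunc_seg, min_eq_left le_top,
      seg_eq_zero g (WithTop.coe_le_coe.2 i.2)]
  let e := LinearEquiv.ofInjective T hTinj
  let ρ : segSpan g ⊤ →ₗ[S] LinearMap.range T :=
    (LinearMap.id - trunc S K γ).restrict fun x hx => hmem hx
  refine ⟨e.symm.toLinearMap ∘ₗ ρ, e.symm.surjective.comp fun y => ?_, fun h => ?_⟩
  · obtain ⟨hy, hy'⟩ := hTrange y.2
    refine ⟨⟨y, hy⟩, Subtype.ext ?_⟩
    change (y : ∀ j, K j) - trunc S K γ y = y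
    rw [LinearMap.mem_ker.1 hy', sub_zero]
  · rw [LinearMap.comp_apply, LinearEquiv.coe_coe, LinearEquiv.map_eq_zero_iff, ← Subtype.coe_inj]
    change (h : ∀ j, K j) - trunc S K γ h = 0 ↔ _
    rw [sub_eq_zero]
    constructor
    · intro h'
      rw [h']
      have := trunc_mem_segSpan g (γ := γ) h.2
      rwa [min_eq_left le_top] at this
    · intro h'
      exact (trunc_eq_self g le_rfl h').symm

end Segments

/-! ### The height at which two sequences separate. -/

section Meet

variable {J : Type u} [LinearOrder J] [WellFoundedLT J] {X : Type u}

open Classical in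
/-- The least index at which two sequences differ, or `⊤` if they are equal. -/
noncomputable def meet (b c : J → X) : WithTop J :=
  if h : ∃ i, b i ≠ c i then (wellFounded_lt.min {i | b i ≠ c i} h : J) else ⊤

theorem lt_meet_iff {b c : J → X} {j : J} : (j : WithTop J) < meet b c ↔ ∀ i ≤ j, b i = c i := by
  unfold meet
  split_ifs with h
  · rw [WithTop.coe_lt_coe]
    constructor
    · intro hj i hi
      by_contra hne
      exact wellFounded_lt.not_lt_min {i | b i ≠ c i} hne (hi.trans_lt hj)
    · intro hj
      by_contra hlt
      exact wellFounded_lt.min_mem {i | b i ≠ c i} h (hj _ (not_lt.1 hlt))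
  · push Not at h
    simp [h, WithTop.coe_lt_top]

theorem meet_self (b : J → X) : meet b b = ⊤ := by
  simp [meet]

theorem meet_le_of_ne {b c : J → X} {i : J} (h : b i ≠ c i) : meet b c ≤ i :=
  not_lt.1 fun hlt => h (lt_meet_iff.1 hlt i le_rfl)

theorem exists_meet_eq {b c : J → X} (h : b ≠ c) : ∃ i, meet b c ≤ (i : J) := by
  obtain ⟨i, hi⟩ := Function.ne_iff.1 h
  exact ⟨i, meet_le_of_ne hi⟩

end Meet

/-! ### Modules on a tree of sequences. -/

section Tree

variable {S : Type u} [Ring S] {J : Type u} [LinearOrder J] [WellFoundedLT J] {X : Type u}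
  {K : J → Type u} [∀ i, AddCommGroup (K i)] [∀ i, Module S (K i)]
  (g : ∀ i j, i ≤ j → K i →ₗ[S] K j)

variable (S K) in
open Classical in
/-- Place a family on the nodes of the branch `b` of the tree of `X`-valued sequences. A node is
given by a pair `(j, c)`; it stands for the restriction of `c` to the indices up to `j`. -/
noncomputable def onBranch (b : J → X) : (∀ j, K j) →ₗ[S] ∀ w : J × (J → X), K w.1 :=
  LinearMap.pi fun w => if (w.1 : WithTop J) < meet w.2 b then LinearMap.proj w.1 else 0

variable (S K) in
/-- The values on the nodes of the branch `b`. -/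
def evalBranch (b : J → X) : (∀ w : J × (J → X), K w.1) →ₗ[S] ∀ j, K j :=
  LinearMap.pi fun j => LinearMap.proj (j, b)

open Classical in
theorem onBranch_apply (b : J → X) (h : ∀ j, K j) (w : J × (J → X)) :
    onBranch S K b h w = if (w.1 : WithTop J) < meet w.2 b then h w.1 else 0 := by
  simp only [onBranch, LinearMap.pi_apply]
  split_ifs <;> rfl

theorem evalBranch_onBranch (b c : J → X) (h : ∀ j, K j) :
    evalBranch S K b (onBranch S K c h) = trunc S K (meet b c) h := by
  ext j
  rw [trunc_apply]
  exact (onBranch_apply c h (j, b)).trans (by congr)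

theorem evalBranch_onBranch_self (b : J → X) (h : ∀ j, K j) :
    evalBranch S K b (onBranch S K b h) = h := by
  rw [evalBranch_onBranch, meet_self, trunc_top]

theorem onBranch_congr {b c : J → X} {γ : WithTop J} (hγ : γ ≤ meet b c) {h : ∀ j, K j}
    (hh : h ∈ segSpan g γ) : onBranch S K b h = onBranch S K c h := by
  ext w
  rw [onBranch_apply, onBranch_apply, ← trunc_eq_self g le_rfl hh, trunc_apply]
  by_cases hw : (w.1 : WithTop J) < γ
  · have hbc := lt_meet_iff.1 (hw.trans_le hγ)
    have : (w.1 : WithTop J) < meet w.2 b ↔ (w.1 : WithTop J) < meet w.2 c := by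
      rw [lt_meet_iff, lt_meet_iff]
      exact forall₂_congr fun i hi => by rw [hbc i hi]
    simp only [this]
  · simp [hw]

/-- The piecewise coherent families on the initial segment of length `s.2` of the branch `s.1`. -/
noncomputable def branchSpan (s : (J → X) × WithTop J) : Submodule S (∀ w : J × (J → X), K w.1) :=
  (segSpan g s.2).map (onBranch S K s.1)

/-- The tree module on the finite branches in `B` (each given by a sequence and a length) and the
infinite branches `η d`. -/
noncomputable def treeSpan (B : Set ((J → X) × J)) {D : Type*} (η : D → J → X) :
    Submodule S (∀ w : J × (J → X), K w.1) :=
  (⨆ p : B, branchSpan g (p.1.1, (p.1.2 : WithTop J))) ⊔ ⨆ d, branchSpan g (η d, ⊤)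

theorem branchSpan_le {b c : J → X} {γ δ : WithTop J} (h : γ ≤ δ) (h' : γ ≤ meet b c) :
    branchSpan g (b, γ) ≤ branchSpan g (c, δ) := by
  rintro _ ⟨x, hx, rfl⟩
  exact ⟨x, segSpan_mono g h hx, (onBranch_congr g h' hx).symm⟩

theorem evalBranch_mem {b : J → X} {s : (J → X) × WithTop J} {x : ∀ w : J × (J → X), K w.1}
    (hx : x ∈ branchSpan g s) :
    evalBranch S K b x ∈ segSpan g (min (meet b s.1) s.2) := by
  obtain ⟨h, hh, rfl⟩ := hx
  rw [evalBranch_onBranch]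
  exact trunc_mem_segSpan g hh

/-- The retraction erases every node off the finitely many segments in `T`. The nodes surviving on
any branch form an initial segment shared with a member of `T`, so the erased family is a truncation
and remains piecewise coherent. -/
theorem exists_branch_retract (T : Finset ((J → X) × WithTop J)) :
    ∃ r : (∀ w : J × (J → X), K w.1) →ₗ[S] ∀ w : J × (J → X), K w.1,
      (∀ s, ∀ x ∈ branchSpan g s, r x ∈ ⨆ t ∈ T, branchSpan g t) ∧
      ∀ s ∈ T, ∀ x ∈ branchSpan g s, r x = x := by
  classical
  let p : J × (J → X) → Prop := fun w => ∃ s ∈ T, (w.1 : WithTop J) < min (meet w.2 s.1) s.2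
  let r : (∀ w : J × (J → X), K w.1) →ₗ[S] ∀ w : J × (J → X), K w.1 :=
    LinearMap.pi fun w => if p w then LinearMap.proj w else 0
  have hr : ∀ x w, r x w = if p w then x w else 0 := fun x w => by
    simp only [r, LinearMap.pi_apply]
    split_ifs <;> rfl
  refine ⟨r, fun s x hx => ?_, fun s hs x hx => ?_⟩
  · rcases T.eq_empty_or_nonempty with rfl | hT
    · have : r x = 0 := by
        ext w
        rw [hr, if_neg (by simp [p])]
        rfl
      rw [this]
      exact zero_mem _
    -- Finiteness of `T` enters here: some `t` shares the longest initial segment with the given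
    -- branch.
    · obtain ⟨t, ht, hmax⟩ := T.exists_max_image (fun t => min (meet s.1 t.1) t.2) hT
      obtain ⟨h, hh, rfl⟩ := hx
      have key : r (onBranch S K s.1 h) =
          onBranch S K s.1 (trunc S K (min (meet s.1 t.1) t.2) h) := by
        ext w
        rw [hr, onBranch_apply, onBranch_apply, trunc_apply]
        by_cases hw : (w.1 : WithTop J) < meet w.2 s.1
        · have hw' := lt_meet_iff.1 hw
          have hcongr : ∀ t : (J → X) × WithTop J,
              (w.1 : WithTop J) < meet w.2 t.1 ↔ (w.1 : WithTop J) < meet s.1 t.1 := fun t => by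
            rw [lt_meet_iff, lt_meet_iff]
            exact forall₂_congr fun i hi => by rw [hw' i hi]
          have : p w ↔ (w.1 : WithTop J) < min (meet s.1 t.1) t.2 := by
            constructor
            · rintro ⟨t', ht', h1⟩
              refine lt_of_lt_of_le ?_ (hmax t' ht')
              rwa [lt_min_iff, hcongr, ← lt_min_iff] at h1
            · intro h1
              refine ⟨t, ht, ?_⟩
              rwa [lt_min_iff, hcongr, ← lt_min_iff]
          simp only [this, hw, if_true]
        · simp [hw]
      rw [key]
      have hle : branchSpan g (s.1, min (min (meet s.1 t.1) t.2) s.2) ≤ branchSpan g t :=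
        branchSpan_le g ((min_le_left _ _).trans (min_le_right _ _))
          ((min_le_left _ _).trans (min_le_left _ _))
      exact Submodule.mem_iSup_of_mem t (Submodule.mem_iSup_of_mem ht
        (hle ⟨_, trunc_mem_segSpan g hh, rfl⟩))
  · obtain ⟨h, hh, rfl⟩ := hx
    ext w
    rw [hr]
    by_cases hw : p w
    · rw [if_pos hw]
    · rw [if_neg hw, onBranch_apply, ← trunc_eq_self g le_rfl hh, trunc_apply]
      by_cases h1 : (w.1 : WithTop J) < meet w.2 s.1
      · by_cases h2 : (w.1 : WithTop J) < s.2
        · exact absurd ⟨s, hs, lt_min h1 h2⟩ hw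
        · simp [h2]
      · simp [h1]

theorem isPure_branchSpan {I : Type*} (br : I → (J → X) × WithTop J) (T : Set I) :
    IsPure ((⨆ i ∈ T, branchSpan g (br i)).submoduleOf (⨆ i, branchSpan g (br i))) := by
  classical
  refine isPure_submoduleOf_biSup _ (fun T => ?_) T
  obtain ⟨r, h1, h2⟩ := exists_branch_retract g (T.image br)
  refine ⟨r, fun i x hx => ?_, fun i hi x hx => h2 _ (Finset.mem_image_of_mem br hi) x hx⟩
  have := h1 _ x hx
  rwa [Finset.iSup_finset_image] at this

/-- `evalBranch` is a left inverse of `onBranch`, so the factor can be computed on the branch alone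
once the trace of `U` there is known to be `W`. -/
theorem exists_branch_factor {s : (J → X) × WithTop J}
    {W : Submodule S (∀ j, K j)} {Y : Type u} [AddCommGroup Y] [Module S Y]
    (φ : segSpan g s.2 →ₗ[S] Y) (hφ : Function.Surjective φ)
    (hker : ∀ h, φ h = 0 ↔ (h : ∀ j, K j) ∈ W) {U : Submodule S (∀ w : J × (J → X), K w.1)}
    (hW : ∀ h ∈ W, onBranch S K s.1 h ∈ U) (hU : ∀ x ∈ U, evalBranch S K s.1 x ∈ W) :
    ∃ f : branchSpan g s →ₗ[S] Y, Function.Surjective f ∧ ∀ x, f x = 0 ↔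
      (x : ∀ w : J × (J → X), K w.1) ∈ U := by
  have hmem : ∀ x ∈ branchSpan g s, evalBranch S K s.1 x ∈ segSpan g s.2 := by
    rintro _ ⟨h, hh, rfl⟩
    rwa [evalBranch_onBranch_self]
  refine ⟨φ ∘ₗ (evalBranch S K s.1).restrict hmem, fun y => ?_, ?_⟩
  · obtain ⟨h, rfl⟩ := hφ y
    refine ⟨⟨onBranch S K s.1 h, h, h.2, rfl⟩, ?_⟩
    rw [LinearMap.comp_apply]
    exact congrArg φ (Subtype.ext (evalBranch_onBranch_self s.1 _))
  · rintro ⟨_, h, hh, rfl⟩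
    rw [LinearMap.comp_apply, hker]
    change evalBranch S K s.1 (onBranch S K s.1 h) ∈ W ↔ onBranch S K s.1 h ∈ U
    constructor
    · intro h1
      rw [evalBranch_onBranch_self] at h1
      exact hW h h1
    · exact hU _

variable [DirectedSystem K fun i j h => g i j h]
  {A : CategoryTheory.ObjectProperty (ModuleCat.{u} S)} [A.IsClosedUnderIsomorphisms]

/-- The lexicographic key places a ladder `d` after all segments of length at most `f d`. By then
its part below `f d` is present, and earlier segments and ladders meet it no higher than `f d`. What
it adds is therefore `segSpan g ⊤` modulo `segSpan g (f d)`, a direct sum. -/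
theorem ClosedUnderPureFiltrations.treeModule (hA : ClosedUnderPureFiltrations A)
    (hK : ∀ i, A (ModuleCat.of S (K i)))
    (hstep : ∀ γ : J, ∃ (Y : ModuleCat.{u} S) (φ : segSpan g (γ : WithTop J) →ₗ[S] Y), A Y ∧
      Function.Surjective φ ∧ ∀ h, φ h = 0 ↔ (h : ∀ j, K j) ∈ segSpanLT g (γ : WithTop J))
    (B : Set ((J → X) × J)) (hB : ∀ b γ γ', γ' < γ → (b, γ) ∈ B → (b, γ') ∈ B)
    {D : Type u} (η : D → J → X) (hη : ∀ d γ, (η d, γ) ∈ B) (f : D → J)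
    (hf : ∀ d d', d ≠ d' → meet (η d) (η d') ≤ max (f d) (f d')) :
    A (ModuleCat.of S (treeSpan g B η)) := by
  let br : B ⊕ D → (J → X) × WithTop J :=
    Sum.elim (fun p => (p.1.1, (p.1.2 : WithTop J))) fun d => (η d, ⊤)
  let key : B ⊕ D → J ×ₗ ℕ := Sum.elim (fun p => toLex (p.1.2, 0)) fun d => toLex (f d, 1)
  have hsum : treeSpan g B η = ⨆ i, branchSpan g (br i) := by
    rw [iSup_sum]
    rfl
  rw [hsum]
  refine hA.of_key key _ (fun i T hlt hT => ?_) fun T => isPure_branchSpan g br T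
  have hle : ∀ j ∈ T, branchSpan (S := S) g (br j) ≤ ⨆ j ∈ T, branchSpan g (br j) :=
    fun j hj => le_iSup₂_of_le (f := fun j (_ : j ∈ T) => branchSpan (S := S) g (br j)) j hj le_rfl
  rcases i with ⟨⟨b, γ⟩, hb⟩ | d
  -- Either the segment is already contained in an earlier one, as happens when two sequences agree
  -- below `γ`, and adds nothing; or all earlier branches leave it strictly below `γ`, and `hstep`
  -- gives the factor.
  · by_cases hex : ∃ j ∈ T, (γ : WithTop J) ≤ min (meet b (br j).1) (br j).2
    · obtain ⟨j, hj, hj'⟩ := hex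
      refine ⟨ModuleCat.of S PUnit, 0, hA.punit, fun y => ⟨0, rfl⟩, fun x => ?_⟩
      simp only [LinearMap.zero_apply, true_iff]
      exact hle j hj
        (branchSpan_le g (hj'.trans (min_le_right _ _)) (hj'.trans (min_le_left _ _)) x.2)
    · push Not at hex
      obtain ⟨Y, φ, hY, hφ, hker⟩ := hstep γ
      have hW : ∀ h ∈ segSpanLT g (γ : WithTop J),
          onBranch S K b h ∈ ⨆ j ∈ T, branchSpan g (br j) := by
        suffices segSpanLT g (γ : WithTop J) ≤
            (⨆ j ∈ T, branchSpan g (br j)).comap (onBranch S K b) from fun h hh => this hh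
        refine segSpanLT_le_of_forall g fun γ' hγ' x hx => ?_
        lift γ' to J using (hγ'.trans_le le_top).ne
        have hγ'' : γ' < γ := WithTop.coe_lt_coe.1 hγ'
        refine hle (Sum.inl ⟨(b, γ'), hB b γ γ' hγ'' hb⟩) (hlt _ ?_) ⟨x, hx, rfl⟩
        exact Prod.Lex.toLex_lt_toLex.2 (Or.inl hγ'')
      have hU : ∀ x ∈ ⨆ j ∈ T, branchSpan g (br j),
          evalBranch S K b x ∈ segSpanLT g (γ : WithTop J) := by
        suffices (⨆ j ∈ T, branchSpan g (br j)) ≤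
            (segSpanLT g (γ : WithTop J)).comap (evalBranch S K b) from fun h hh => this hh
        exact iSup₂_le fun j hj x hx => segSpan_le_segSpanLT g (hex j hj) (evalBranch_mem g hx)
      obtain ⟨f, hf, hf'⟩ := exists_branch_factor g (s := (b, (γ : WithTop J))) φ hφ hker hW hU
      exact ⟨Y, f, hY, hf, hf'⟩
  · obtain ⟨φ, hφ, hker⟩ := exists_equiv_directSum g (f d)
    have hW : ∀ h ∈ segSpan g (f d : WithTop J),
        onBranch S K (η d) h ∈ ⨆ j ∈ T, branchSpan g (br j) := by
      intro h hh
      refine hle (Sum.inl ⟨(η d, f d), hη d _⟩) (hlt _ ?_) ⟨h, hh, rfl⟩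
      exact Prod.Lex.toLex_lt_toLex.2 (Or.inr ⟨rfl, Nat.zero_lt_one⟩)
    have hU : ∀ x ∈ ⨆ j ∈ T, branchSpan g (br j),
        evalBranch S K (η d) x ∈ segSpan g (f d : WithTop J) := by
      suffices (⨆ j ∈ T, branchSpan g (br j)) ≤
            (segSpan g (f d : WithTop J)).comap (evalBranch S K (η d)) from fun h hh => this hh
      refine iSup₂_le fun j hj x hx => segSpan_mono g ?_ (evalBranch_mem g hx)
      obtain ⟨hkey, hne⟩ := hT j hj
      rcases j with ⟨⟨b, γ⟩, hb⟩ | d'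
      · refine (min_le_right _ _).trans (WithTop.coe_le_coe.2 ?_)
        rcases Prod.Lex.toLex_le_toLex.1 hkey with h | h
        · exact h.le
        · exact h.1.le
      · refine (min_le_left _ _).trans ((hf d d' fun h => hne (by rw [h])).trans ?_)
        have : f d' ≤ f d := by
          rcases Prod.Lex.toLex_le_toLex.1 hkey with h | h
          · exact h.le
          · exact h.1.le
        exact max_le le_rfl (WithTop.coe_le_coe.2 this)
    obtain ⟨f', hf', hf''⟩ := exists_branch_factor g (s := (η d, ⊤)) φ hφ hker hW hU
    exact ⟨ModuleCat.of S _, f', hA.directSum _ fun i => hK i, hf', hf''⟩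

end Tree

/-! ### Ladder systems on non-reflecting sets. -/

section Ladders

open Order

theorem isSuccLimit_of_aleph0_le_cof {δ : Ordinal.{u}} (h : ℵ₀ ≤ δ.cof) : IsSuccLimit δ :=
  Ordinal.one_lt_cof_iff.1 (Ordinal.aleph0_le_cof_iff.1 h)

theorem mk_Iio_ordToType_lt {c : Cardinal.{u}} (i : c.ord.ToType) : #(Set.Iio i) < c := by
  simpa using mk_Iio_lt i (by simp)

theorem exists_ladder {θ : Cardinal.{u}} (hθ : ℵ₀ ≤ θ) {δ : Ordinal.{u}} (hδ : δ.cof = θ) :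
    ∃ a : θ.ord.ToType → Ordinal.{u}, (∀ i, a i < δ) ∧ ∀ β < δ, ∃ i, ∀ j, i ≤ j → β < a j := by
  obtain ⟨f, hf⟩ := Ordinal.exists_isFundamentalSeq (o := δ) (a := θ.ord) (by rw [hδ])
  have hlim : IsSuccLimit δ := isSuccLimit_of_aleph0_le_cof (hδ ▸ hθ)
  refine ⟨fun i => f (Ordinal.ToType.mk.symm i), fun i => (f _).2, fun β hβ => ?_⟩
  obtain ⟨_, ⟨i, rfl⟩, hi⟩ := hf.isCofinal_range ⟨β + 1, hlim.add_one_lt hβ⟩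
  refine ⟨Ordinal.ToType.mk i, fun j hj => ?_⟩
  have h1 : i ≤ Ordinal.ToType.mk.symm j := by
    rwa [OrderIso.le_symm_apply]
  have h2 : f i ≤ f (Ordinal.ToType.mk.symm j) := hf.strictMono.monotone h1
  exact (lt_add_one β).trans_le (le_trans (show β + 1 ≤ (f i : Ordinal) from hi) h2)

/-- Below `ε`, there is a cofinal set avoiding `E` that has no limit points in `E`. -/
theorem exists_gaps {l : Ordinal.{u}} {E : Set Ordinal.{u}} (hE : ∀ δ ∈ E, IsSuccLimit δ)
    (hl : NonReflecting l E) {ε : Ordinal.{u}} (hε : IsSuccLimit ε) (hεl : ε < l) :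
    ∃ C ⊆ Set.Iio ε, (∀ c ∈ C, c ∉ E) ∧ (∀ b < ε, ∃ c ∈ C, b < c) ∧
      ∀ δ ∈ E, δ < ε → ∀ β < δ, ∃ m ∈ insert β C, m < δ ∧ ∀ c ∈ insert β C, c < δ → c ≤ m := by
  rcases (Ordinal.aleph0_le_cof_iff.2 (Ordinal.one_lt_cof_iff.2 hε)).eq_or_lt with h | h
  · obtain ⟨a, ha, ha'⟩ := exists_ladder le_rfl h.symm
    -- Successors avoid `E`, which consists of limits; only finitely many terms of an `ω`-sequence
    -- cofinal in `ε` lie below a given `δ < ε`.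
    refine ⟨Set.range fun i => a i + 1, ?_, ?_, fun b hb => ?_, fun δ hδ hδε β hβ => ?_⟩
    · rintro _ ⟨i, rfl⟩
      exact hε.add_one_lt (ha i)
    · rintro _ ⟨i, rfl⟩ hi
      exact not_isSuccLimit_add_one _ (hE _ hi)
    · obtain ⟨i, hi⟩ := ha' b hb
      exact ⟨_, ⟨i, rfl⟩, (hi i le_rfl).trans (lt_add_one _)⟩
    · obtain ⟨i, hi⟩ := ha' δ hδε
      have hfin : {c ∈ insert β (Set.range fun i => a i + 1) | c < δ}.Finite := by
        have : (Set.Iio i).Finite := Cardinal.lt_aleph0_iff_set_finite.1 (mk_Iio_ordToType_lt i)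
        refine ((this.image fun i => a i + 1).insert β).subset ?_
        rintro c ⟨rfl | ⟨j, rfl⟩, hc⟩
        · exact Or.inl rfl
        · refine Or.inr ⟨j, ?_, rfl⟩
          by_contra hj
          exact lt_asymm hc ((hi j (not_lt.1 hj)).trans (lt_add_one _))
      obtain ⟨m, hm, hm'⟩ := Set.exists_max_image _ id hfin ⟨β, Set.mem_insert _ _, hβ⟩
      exact ⟨m, hm.1, hm.2, fun c hc hc' => hm' c ⟨hc, hc'⟩⟩
  -- Non-reflection provides a club disjoint from `E`. The supremum of its part below `δ ∈ E`
  -- belongs to the club, hence differs from `δ`.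
  · obtain ⟨t, ht, hdisj⟩ := not_isStationary_iff.1 (hl ε hεl h)
    have hCE : ∀ c ∈ Subtype.val '' t, c ∉ E := by
      rintro _ ⟨c, hc, rfl⟩ hcE
      exact Set.disjoint_left.1 hdisj hcE hc
    refine ⟨Subtype.val '' t, ?_, hCE, fun b hb => ?_, fun δ hδ hδε β hβ => ?_⟩
    · rintro _ ⟨c, _, rfl⟩
      exact c.2
    · obtain ⟨c, hc, hbc⟩ := ht.isCofinal ⟨b + 1, hε.add_one_lt hb⟩
      exact ⟨c, ⟨c, hc, rfl⟩, (lt_add_one b).trans_le hbc⟩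
    · rcases ({c ∈ t | (c : Ordinal) < δ}).eq_empty_or_nonempty with h0 | h0
      · refine ⟨β, Set.mem_insert _ _, hβ, ?_⟩
        rintro c (rfl | ⟨c, hc, rfl⟩) hcδ
        · exact le_rfl
        · exact absurd (show c ∈ {c ∈ t | (c : Ordinal) < δ} from ⟨hc, hcδ⟩) (by simp [h0])
      · have hne : (Subtype.val '' {c ∈ t | (c : Ordinal) < δ}).Nonempty := h0.image _
        have hub : δ ∈ upperBounds (Subtype.val '' {c ∈ t | (c : Ordinal) < δ}) := by
          rintro _ ⟨c, hc, rfl⟩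
          exact hc.2.le
        have hlub := isLUB_csSup hne ⟨δ, hub⟩
        set s := sSup (Subtype.val '' {c ∈ t | (c : Ordinal) < δ}) with hs
        have hsδ : s ≤ δ := hlub.2 hub
        have hst : (⟨s, hsδ.trans_lt hδε⟩ : Set.Iio ε) ∈ t := by
          refine ht.isLUB_mem (Set.sep_subset _ _) h0 ⟨fun c hc => ?_, fun c hc => ?_⟩
          · exact hlub.1 ⟨c, hc, rfl⟩
          · refine hlub.2 ?_
            rintro _ ⟨d, hd, rfl⟩
            exact hc hd
        have hsC : s ∈ Subtype.val '' t := ⟨_, hst, rfl⟩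
        have hsδ' : s < δ := hsδ.lt_of_ne fun h => hCE s hsC (h ▸ hδ)
        refine ⟨max β s, ?_, max_lt hβ hsδ', ?_⟩
        · rcases max_choice β s with h | h <;> rw [h]
          · exact Or.inl rfl
          · exact Or.inr hsC
        · rintro c (rfl | ⟨c, hc, rfl⟩) hcδ
          · exact le_max_left _ _
          · exact (hlub.1 ⟨c, ⟨hc, hcδ⟩, rfl⟩).trans (le_max_right _ _)

/-- Ladders on a non-reflecting set can be made disjoint by removing initial segments, as long as
only a bounded part of the set is considered. -/
theorem exists_free {l : Ordinal.{u}} {E : Set Ordinal.{u}} (hE : ∀ δ ∈ E, IsSuccLimit δ)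
    (hl : NonReflecting l E) {J : Type*} [LinearOrder J] [Nonempty J]
    (η : Ordinal.{u} → J → Ordinal.{u})
    (hη : ∀ δ ∈ E, ∀ i, η δ i < δ) (hη' : ∀ δ ∈ E, ∀ β < δ, ∃ i, ∀ j, i ≤ j → β < η δ j)
    (ε : Ordinal.{u}) (hε : ε < l) : ∀ β : Ordinal.{u}, ∃ f : Ordinal.{u} → J,
      (∀ δ ∈ E, β < δ → δ < ε → ∀ i, f δ ≤ i → β < η δ i) ∧
      ∀ δ ∈ E, β < δ → δ < ε → ∀ δ' ∈ E, β < δ' → δ' < ε → δ ≠ δ' →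
        ∃ i ≤ max (f δ) (f δ'), η δ i ≠ η δ' i := by
  have hne : ∀ δ ∈ E, ∀ δ' ∈ E, δ < δ' → ∃ i, η δ i ≠ η δ' i := by
    intro δ hδ δ' hδ' h
    obtain ⟨i, hi⟩ := hη' δ' hδ' δ h
    exact ⟨i, ((hη δ hδ i).trans (hi i le_rfl)).ne⟩
  -- The lower bound `β` stays universally quantified: the limit case needs the induction hypothesis
  -- above varying lower bounds.
  induction ε using WellFoundedLT.induction with
  | ind ε ih =>
  intro β
  rcases Ordinal.zero_or_succ_or_isSuccLimit ε with rfl | ⟨ε', rfl⟩ | hlim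
  · exact ⟨fun _ => Classical.arbitrary J, fun δ _ _ h => absurd h not_lt_zero,
      fun δ _ _ h => absurd h not_lt_zero⟩
  · have hε' : ε' < succ ε' := lt_succ ε'
    obtain ⟨f, hf, hf'⟩ := ih ε' hε' (hε'.trans hε) β
    by_cases h : ε' ∈ E ∧ β < ε'
    · obtain ⟨i₀, hi₀⟩ := hη' ε' h.1 β h.2
      choose! d hd using fun δ hδ (hδ' : δ < ε') => hne δ hδ ε' h.1 hδ'
      classical
      -- The new ladder only has to exceed `β`; each older index is raised to a place `d δ` where
      -- its ladder differs from the new one.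
      refine ⟨fun δ => if δ = ε' then i₀ else max (f δ) (d δ), ?_, ?_⟩
      · intro δ hδ hβ hlt i hi
        by_cases hδε : δ = ε'
        · subst hδε
          beta_reduce at hi
          rw [if_pos rfl] at hi
          exact hi₀ i hi
        · beta_reduce at hi
          rw [if_neg hδε] at hi
          exact hf δ hδ hβ ((lt_succ_iff.1 hlt).lt_of_ne hδε) i ((le_max_left _ _).trans hi)
      · intro δ hδ hβ hlt δ' hδ' hβ' hlt' hδδ'
        by_cases h1 : δ = ε'
        · subst h1
          have h2 : δ' < δ := (lt_succ_iff.1 hlt').lt_of_ne hδδ'.symm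
          refine ⟨d δ', ?_, (hd δ' hδ' h2).symm⟩
          simp [hδδ'.symm]
        · have h2 : δ < ε' := (lt_succ_iff.1 hlt).lt_of_ne h1
          by_cases h3 : δ' = ε'
          · subst h3
            refine ⟨d δ, ?_, hd δ hδ h2⟩
            simp [h1]
          · obtain ⟨i, hi, hi'⟩ := hf' δ hδ hβ h2 δ' hδ' hβ' ((lt_succ_iff.1 hlt').lt_of_ne h3) hδδ'
            refine ⟨i, hi.trans ?_, hi'⟩
            beta_reduce
            rw [if_neg h1, if_neg h3]
            exact max_le_max (le_max_left _ _) (le_max_left _ _)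
    · have key : ∀ δ ∈ E, β < δ → δ < succ ε' → δ < ε' := fun δ hδ hβ hlt =>
        (lt_succ_iff.1 hlt).lt_of_ne fun h' => h ⟨h' ▸ hδ, h' ▸ hβ⟩
      exact ⟨f, fun δ hδ hβ hlt => hf δ hδ hβ (key δ hδ hβ hlt), fun δ hδ hβ hlt δ' hδ' hβ' hlt' =>
        hf' δ hδ hβ (key δ hδ hβ hlt) δ' hδ' hβ' (key δ' hδ' hβ' hlt')⟩
  -- The points of `C` and `β` cut the interval into blocks. Each relevant `δ ∈ E` lies strictly
  -- between `lo δ` and `hi δ`, and the induction hypothesis is applied inside that block.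
  · obtain ⟨C, hCε, hCE, hcof, hgap⟩ := exists_gaps hE hl hlim hε
    choose! F hF hF' using fun c (hc : c < ε) => ih c hc (hc.trans hε)
    choose! lo hlo hlo' hlo'' using fun δ hδ (hδ' : δ < ε) (hβ : β < δ) => hgap δ hδ hδ' β hβ
    have hhi : ∀ δ < ε, ∃ c ∈ C, δ < c ∧ ∀ c' ∈ C, δ < c' → c ≤ c' := by
      intro δ hδ
      obtain ⟨c, hc, hδc⟩ := hcof δ hδ
      have hS : {c ∈ C | δ < c}.Nonempty := ⟨c, hc, hδc⟩
      exact ⟨sInf {c ∈ C | δ < c}, (csInf_mem hS).1, (csInf_mem hS).2,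
        fun c' hc' hlt => csInf_le' ⟨hc', hlt⟩⟩
    choose! hi hhi hhi' hhi'' using hhi
    have hgt : ∀ δ ∈ E, β < δ → δ < ε → ∀ i, F (hi δ) (lo δ) δ ≤ i → lo δ < η δ i :=
      fun δ hδ hβ hlt i h => hF (hi δ) (hCε (hhi δ hlt)) (lo δ) δ hδ (hlo' δ hδ hlt hβ)
        (hhi' δ hlt) i h
    have hβlo : ∀ δ ∈ E, β < δ → δ < ε → β ≤ lo δ := fun δ hδ hβ hlt =>
      hlo'' δ hδ hlt hβ β (Set.mem_insert _ _) hβ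
    have main : ∀ δ ∈ E, β < δ → δ < ε → ∀ δ' ∈ E, β < δ' → δ' < ε → δ < δ' →
        ∃ i ≤ max (F (hi δ) (lo δ) δ) (F (hi δ') (lo δ') δ'), η δ i ≠ η δ' i := by
      intro δ hδ hβ hlt δ' hδ' hβ' hlt' hδδ'
      -- In different blocks, at the larger index `i`, `η δ i < δ < hi δ ≤ lo δ' < η δ' i`.
      -- Otherwise both lie in the same block and the induction hypothesis separates them.
      by_cases h : hi δ < δ'
      · refine ⟨_, le_rfl, ne_of_lt ?_⟩
        refine (hη δ hδ _).trans ((hhi' δ hlt).trans ?_)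
        exact (hlo'' δ' hδ' hlt' hβ' _ (Set.mem_insert_of_mem _ (hhi δ hlt)) h).trans_lt
          (hgt δ' hδ' hβ' hlt' _ (le_max_right _ _))
      · have h' : δ' < hi δ := (not_lt.1 h).lt_of_ne fun h => hCE _ (hhi δ hlt) (h ▸ hδ')
        have hhieq : hi δ' = hi δ := le_antisymm (hhi'' δ' hlt' _ (hhi δ hlt) h')
          (hhi'' δ hlt _ (hhi δ' hlt') (hδδ'.trans (hhi' δ' hlt')))
        have hlt2 : lo δ' < δ := by
          by_contra hge
          rcases hlo δ' hδ' hlt' hβ' with h1 | h1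
          · exact hge (h1 ▸ hβ)
          · have h2 : δ < lo δ' := (not_lt.1 hge).lt_of_ne fun h2 => hCE _ h1 (h2 ▸ hδ)
            exact absurd ((hhi'' δ hlt _ h1 h2).trans_lt (hlo' δ' hδ' hlt' hβ')) h
        have hloeq : lo δ' = lo δ := le_antisymm
          (hlo'' δ hδ hlt hβ _ (hlo δ' hδ' hlt' hβ') hlt2)
          (hlo'' δ' hδ' hlt' hβ' _ (hlo δ hδ hlt hβ) ((hlo' δ hδ hlt hβ).trans hδδ'))
        rw [hhieq, hloeq]
        exact hF' (hi δ) (hCε (hhi δ hlt)) (lo δ) δ hδ (hlo' δ hδ hlt hβ) (hhi' δ hlt) δ' hδ'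
          ((hlo' δ hδ hlt hβ).trans hδδ') h' hδδ'.ne
    refine ⟨fun δ => F (hi δ) (lo δ) δ, fun δ hδ hβ hlt i h =>
      (hβlo δ hδ hβ hlt).trans_lt (hgt δ hδ hβ hlt i h), ?_⟩
    intro δ hδ hβ hlt δ' hδ' hβ' hlt' hδδ'
    rcases hδδ'.lt_or_gt with h | h
    · exact main δ hδ hβ hlt δ' hδ' hβ' hlt' h
    · obtain ⟨i, hi, hi'⟩ := main δ' hδ' hβ' hlt' δ hδ hβ hlt h
      exact ⟨i, by rwa [max_comm], hi'.symm⟩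

end Ladders

/-! ### Counting the generators of a tree module. -/

section Cardinality

variable {S : Type u} [Ring S]

theorem mk_span_le_of_le {M : Type u} [AddCommGroup M] [Module S M] {κ : Cardinal.{u}}
    (hκ : ℵ₀ ≤ κ) (hS : #S ≤ κ) {s : Set M} (hs : #s ≤ κ) : #(Submodule.span S s) ≤ κ := by
  classical
  have h1 : #(Submodule.span S s) ≤ #(s →₀ S) := by
    have : Submodule.span S s = LinearMap.range (Finsupp.linearCombination S ((↑) : s → M)) := by
      rw [Finsupp.range_linearCombination, Subtype.range_coe]
    rw [this]
    exact mk_range_le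
  have h2 : #(s →₀ S) ≤ #(Finset (s × S)) :=
    mk_le_of_injective (Finsupp.graph_injective s S)
  have h3 : #(Finset (s × S)) ≤ #(List (s × S)) :=
    mk_le_of_surjective List.toFinset_surjective
  have h4 : #(s × S) ≤ κ := by
    rw [mk_prod, lift_id, lift_id]
    exact mul_le_of_le hκ hs hS
  exact h1.trans (h2.trans (h3.trans ((mk_list_le_max _).trans (max_le hκ h4))))

variable {J : Type u} [LinearOrder J] [WellFoundedLT J] {X : Type u}
  {K : J → Type u} [∀ i, AddCommGroup (K i)] [∀ i, Module S (K i)]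
  (g : ∀ i j, i ≤ j → K i →ₗ[S] K j)

/-- Values of a sequence beyond its stated length do not affect the span, so only representatives
`B'` have to be counted. -/
theorem mk_treeSpan_le {κ : Cardinal.{u}} (hκ : ℵ₀ ≤ κ) (hS : #S ≤ κ) (hJ : #J ≤ κ)
    (hK : #(Σ i, K i) ≤ κ) {B B' : Set ((J → X) × J)} (hB' : #B' ≤ κ)
    (hB : ∀ b γ, (b, γ) ∈ B → ∃ b', (b', γ) ∈ B' ∧ (γ : WithTop J) ≤ meet b b')
    {D : Type u} (hD : #D ≤ κ) (η : D → J → X) : #(treeSpan g B η) ≤ κ := by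
  let br : B' ⊕ D → J → X := Sum.elim (fun p => p.1.1) η
  let gen : (B' ⊕ D) × WithTop J × (Σ i, K i) → ∀ w : J × (J → X), K w.1 :=
    fun p => onBranch S K (br p.1) (seg g p.2.1 p.2.2.1 p.2.2.2)
  have hle : ∀ i γ, branchSpan g (br i, γ) ≤ Submodule.span S (Set.range gen) := by
    intro i γ
    rw [branchSpan, Submodule.map_le_iff_le_comap, segSpan_le_iff]
    intro γ' _ j x
    exact Submodule.subset_span ⟨(i, γ', ⟨j, x⟩), rfl⟩
  have hle' : treeSpan g B η ≤ Submodule.span S (Set.range gen) := by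
    refine sup_le (iSup_le fun p => ?_) (iSup_le fun d => hle (Sum.inr d) ⊤)
    obtain ⟨b', hb', hm⟩ := hB p.1.1 p.1.2 p.2
    exact (branchSpan_le g le_rfl hm).trans (hle (Sum.inl ⟨_, hb'⟩) _)
  refine (mk_le_of_injective (Submodule.inclusion_injective hle')).trans
    (mk_span_le_of_le hκ hS (mk_range_le.trans ?_))
  have h1 : #(B' ⊕ D) ≤ κ := by
    rw [mk_sum, lift_id, lift_id]
    exact add_le_of_le hκ hB' hD
  have h2 : #(WithTop J) ≤ κ := by
    have : #(WithTop J) = #J + 1 := mk_option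
    rw [this]
    exact add_le_of_le hκ hJ (one_le_aleph0.trans hκ)
  rw [mk_prod, mk_prod, lift_id, lift_id, lift_id, lift_id]
  exact mul_le_of_le hκ h1 (mul_le_of_le hκ h2 hK)

end Cardinality

/-! ### A splitting criterion. -/

section Splitting

variable {S : Type u} [Ring S] {M : Type u} [AddCommGroup M] [Module S M]

/-- The complement is the image of the kernel of `π`. -/
theorem splitsIn_of_linearMap {P Q U : Submodule S M} {Y : Type u} [AddCommGroup Y] [Module S Y]
    (π : U →ₗ[S] Y) (hsurj : ∀ u, ∃ q : U, (q : M) ∈ Q ∧ π q = π u)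
    (hP : ∀ q : U, (q : M) ∈ P → π q = 0) (hker : ∀ q : U, (q : M) ∈ Q → π q = 0 → (q : M) ∈ P) :
    SplitsIn P Q U := by
  refine ⟨(LinearMap.ker π).map (P.submoduleOf U).mkQ, ?_, ?_⟩
  · rw [Submodule.disjoint_def]
    rintro _ ⟨q, hq, rfl⟩ ⟨k, hk, hkq⟩
    have hmem : k - q ∈ P.submoduleOf U := by
      rwa [← Submodule.Quotient.eq]
    have h0 : π (k - q) = 0 := hP _ hmem
    rw [map_sub, LinearMap.mem_ker.1 hk, zero_sub, neg_eq_zero] at h0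
    rw [Submodule.mkQ_apply, Submodule.Quotient.mk_eq_zero]
    exact hker q hq h0
  · rw [codisjoint_iff, eq_top_iff]
    rintro x -
    obtain ⟨u, rfl⟩ := Submodule.mkQ_surjective _ x
    obtain ⟨q, hq, hqu⟩ := hsurj u
    have : u = q + (u - q) := by abel
    rw [this, map_add]
    refine Submodule.add_mem_sup ⟨q, hq, rfl⟩ ⟨u - q, ?_, rfl⟩
    rw [SetLike.mem_coe, LinearMap.mem_ker, map_sub, hqu, sub_self]

end Splitting

/-! ### Segment factors of the system restricted to successor indices. -/

section Steps

open Order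

variable {S : Type u} [Ring S] {J : Type u} [LinearOrder J] [SuccOrder J]
  {N : J → Type u} [∀ i, AddCommGroup (N i)] [∀ i, Module S (N i)]
  (g : ∀ i j, i ≤ j → N i →ₗ[S] N j)

/-- The transition maps of the system restricted to successor indices. -/
def succMap (i j : J) (h : i ≤ j) : N (succ i) →ₗ[S] N (succ j) :=
  g (succ i) (succ j) (succ_le_succ h)

theorem exists_map_isMin {γ : J} (hγ : IsMin γ) :
    ∃ φ : segSpan (succMap g) (γ : WithTop J) →ₗ[S] PUnit.{u + 1}, Function.Surjective φ ∧
      ∀ h, φ h = 0 ↔ (h : ∀ j, N (succ j)) ∈ segSpanLT (succMap g) (γ : WithTop J) := by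
  refine ⟨0, fun y => ⟨0, rfl⟩, fun h => ?_⟩
  rw [mem_segSpan_of_isMin (succMap g) hγ h.2]
  simp

variable [DirectedSystem N fun i j h => g i j h]

instance : DirectedSystem (fun i => N (succ i)) fun i j h => succMap g i j h where
  map_self _ x := DirectedSystem.map_self (f := fun i j h => g i j h) x
  map_map _ _ _ hij hjk x := DirectedSystem.map_map (f := fun i j h => g i j h)
    (succ_le_succ hij) (succ_le_succ hjk) x

theorem exists_map_directLimit [Nonempty J] [DecidableEq J] :
    ∃ φ : segSpan (succMap g) ⊤ →ₗ[S] Module.DirectLimit N g, Function.Surjective φ ∧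
      ∀ h, φ h = 0 ↔ (h : ∀ j, N (succ j)) ∈ segSpanLT (succMap g) ⊤ := by
  refine exists_eventual_value (succMap g) (γ := ⊤) ⟨Classical.arbitrary J, WithTop.coe_lt_top _⟩
    (fun i _ => Module.DirectLimit.of S J N g (succ i)) ?_ ?_ ?_
  · intro i j hij _ x
    exact Module.DirectLimit.of_f
  · intro y
    obtain ⟨i, x, rfl⟩ := Module.DirectLimit.exists_of y
    exact ⟨i, WithTop.coe_lt_top _, g i (succ i) (le_succ i) x, Module.DirectLimit.of_f⟩
  · intro i _ x hx
    obtain ⟨k, hk, hk'⟩ := Module.DirectLimit.of.zero_exact hx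
    refine ⟨k, (le_succ i).trans hk, WithTop.coe_lt_top _, ?_⟩
    change g (succ i) (succ k) _ x = 0
    rw [← DirectedSystem.map_map (f := fun i j h => g i j h) hk (le_succ k), hk', map_zero]

theorem exists_map_of_isSuccLimit [DecidableEq J] {κ : Cardinal.{u}}
    (hcont : IsContinuousSystem κ N g) {γ : J} (hγ : IsSuccLimit γ) (hκ : #(Set.Iio γ) < κ) :
    ∃ φ : segSpan (succMap g) (γ : WithTop J) →ₗ[S] N γ, Function.Surjective φ ∧
      ∀ h, φ h = 0 ↔ (h : ∀ j, N (succ j)) ∈ segSpanLT (succMap g) (γ : WithTop J) := by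
  have hne : (Set.Iio γ).Nonempty := by
    obtain ⟨i, hi⟩ := not_isMin_iff.1 hγ.not_isMin
    exact ⟨i, hi⟩
  obtain ⟨s, hs, hbij⟩ := hcont (Set.Iio γ) hne (fun a _ b _ _ => le_total a b) hκ
  obtain rfl : s = γ := hs.unique hγ.isLUB_Iio
  have : Nonempty (Set.Iio s) := hne.to_subtype
  refine exists_eventual_value (succMap g) ⟨hne.some, WithTop.coe_lt_coe.2 hne.some_mem⟩
    (fun i hi => g (succ i) s (succ_le_of_lt (WithTop.coe_lt_coe.1 hi))) ?_ ?_ ?_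
  · intro i j hij hj x
    exact DirectedSystem.map_map (f := fun i j h => g i j h) _ _ x
  · intro y
    obtain ⟨z, rfl⟩ := hbij.2 y
    obtain ⟨i, x, rfl⟩ := Module.DirectLimit.exists_of z
    refine ⟨i, WithTop.coe_lt_coe.2 i.2, g i (succ i) (le_succ _) x, ?_⟩
    rw [Module.DirectLimit.lift_of]
    exact DirectedSystem.map_map (f := fun i j h => g i j h) _ _ x
  · intro i hi x hx
    have hi' : succ i < s := hγ.succ_lt (WithTop.coe_lt_coe.1 hi)
    have h0 : Module.DirectLimit.of S (Set.Iio s) (fun j => N j) (fun i j h => g i j h)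
        ⟨succ i, hi'⟩ x = 0 := by
      apply hbij.1
      rw [map_zero, Module.DirectLimit.lift_of]
      exact hx
    have : DirectedSystem (fun j : Set.Iio s => N j) fun i j h => g i j h :=
      ⟨fun _ x => DirectedSystem.map_self (f := fun i j h => g i j h) x,
        fun _ _ _ hij hjk x => DirectedSystem.map_map (f := fun i j h => g i j h) hij hjk x⟩
    obtain ⟨k, hk, hk'⟩ := Module.DirectLimit.of.zero_exact h0
    refine ⟨k, (le_succ i).trans hk, WithTop.coe_lt_coe.2 k.2, ?_⟩
    change g (succ i) (succ k) _ x = 0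
    rw [← DirectedSystem.map_map (f := fun i j h => g i j h) hk (le_succ (k : J)), hk', map_zero]

variable [NoMaxOrder J]

theorem exists_map_succ (α : J) :
    ∃ φ : segSpan (succMap g) ((succ α : J) : WithTop J) →ₗ[S] N (succ α), Function.Surjective φ ∧
      ∀ h, φ h = 0 ↔
        (h : ∀ j, N (succ j)) ∈ segSpanLT (succMap g) ((succ α : J) : WithTop J) := by
  have hα : (α : WithTop J) < (succ α : J) := WithTop.coe_lt_coe.2 (lt_succ α)
  refine exists_eventual_value (succMap g) ⟨α, hα⟩
    (fun i hi => g (succ i) (succ α) (succ_le_of_lt (WithTop.coe_lt_coe.1 hi))) ?_ ?_ ?_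
  · intro i j hij hj x
    exact DirectedSystem.map_map (f := fun i j h => g i j h) _ _ x
  · intro y
    exact ⟨α, hα, y, DirectedSystem.map_self (f := fun i j h => g i j h) y⟩
  · intro i hi x hx
    exact ⟨α, lt_succ_iff.1 (WithTop.coe_lt_coe.1 hi), hα, hx⟩

/-- With successor indices the limit below `γ` is `N γ` itself: trivially for a successor, by
continuity for a limit. At the least index there are no nonzero families. -/
theorem exists_step {A : CategoryTheory.ObjectProperty (ModuleCat.{u} S)}
    (hA : ClosedUnderPureFiltrations A) (hN : ∀ i, A (ModuleCat.of S (N i)))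
    [DecidableEq J] {κ : Cardinal.{u}}
    (hcont : IsContinuousSystem κ N g) (hκ : ∀ γ : J, #(Set.Iio γ) < κ) (γ : J) :
    ∃ (Y : ModuleCat.{u} S) (φ : segSpan (succMap g) (γ : WithTop J) →ₗ[S] Y), A Y ∧
      Function.Surjective φ ∧
      ∀ h, φ h = 0 ↔ (h : ∀ j, N (succ j)) ∈ segSpanLT (succMap g) (γ : WithTop J) := by
  by_cases hmin : IsMin γ
  · obtain ⟨φ, h⟩ := exists_map_isMin g hmin
    exact ⟨ModuleCat.of S PUnit, φ, hA.punit, h⟩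
  · by_cases hlim : IsSuccLimit γ
    · obtain ⟨φ, h⟩ := exists_map_of_isSuccLimit g hcont hlim (hκ γ)
      exact ⟨ModuleCat.of S (N γ), φ, hN γ, h⟩
    · have : ∃ α, succ α = γ := by
        have h : ¬ IsSuccPrelimit γ := fun h => hlim ⟨hmin, h⟩
        obtain ⟨α, hα⟩ := not_isSuccPrelimit_iff.1 h
        exact ⟨α, hα.succ_eq⟩
      obtain ⟨α, rfl⟩ := this
      obtain ⟨φ, h⟩ := exists_map_succ g α
      exact ⟨ModuleCat.of S (N (succ α)), φ, hN _, h⟩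

end Steps

/-! ### The filtration of the tree module, its factors and its size. -/

section TreeFiltration

variable {S : Type u} [Ring S] {J : Type u} [LinearOrder J] [WellFoundedLT J] {X : Type u}
  {K : J → Type u} [∀ i, AddCommGroup (K i)] [∀ i, Module S (K i)]
  (g : ∀ i j, i ≤ j → K i →ₗ[S] K j)
  (val : X → Ordinal.{u}) (E : Set Ordinal.{u}) (η : X → J → X)

/-- The finite branches (given by a sequence and a length) bounded strictly below `α`. -/
def boundedNodes (J : Type u) [LinearOrder J] (α : Ordinal.{u}) : Set ((J → X) × J) :=
  {p | ∃ β < α, ∀ i < p.2, val (p.1 i) < β}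

/-- The tree module on the nodes bounded below `α` and on the ladders of the elements of `E`
below `α`. -/
noncomputable def treeFiltration (α : Ordinal.{u}) : Submodule S (∀ w : J × (J → X), K w.1) :=
  treeSpan g (boundedNodes val J α) fun d : {d : X // val d ∈ E ∧ val d < α} => η d

variable {val E η}

theorem treeFiltration_le_iff {α : Ordinal.{u}} {W : Submodule S (∀ w : J × (J → X), K w.1)} :
    treeFiltration g val E η α ≤ W ↔
      (∀ b γ, (b, γ) ∈ boundedNodes val J α → branchSpan g (b, (γ : WithTop J)) ≤ W) ∧
      ∀ d, val d ∈ E → val d < α → branchSpan g (η d, ⊤) ≤ W := by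
  rw [treeFiltration, treeSpan, sup_le_iff, iSup_le_iff, iSup_le_iff]
  exact ⟨fun h => ⟨fun b γ hb => h.1 ⟨(b, γ), hb⟩, fun d hd hd' => h.2 ⟨d, hd, hd'⟩⟩,
    fun h => ⟨fun p => h.1 p.1.1 p.1.2 p.2, fun d => h.2 d d.2.1 d.2.2⟩⟩

theorem branchSpan_le_treeFiltration {α : Ordinal.{u}} {b : J → X} {γ : J}
    (h : (b, γ) ∈ boundedNodes val J α) :
    branchSpan g (b, (γ : WithTop J)) ≤ treeFiltration g val E η α :=
  ((treeFiltration_le_iff g).1 le_rfl).1 b γ h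

theorem ladder_le_treeFiltration {α : Ordinal.{u}} {d : X} (hd : val d ∈ E) (hd' : val d < α) :
    branchSpan g (η d, ⊤) ≤ treeFiltration g val E η α :=
  ((treeFiltration_le_iff g).1 le_rfl).2 d hd hd'

theorem treeFiltration_mono : Monotone (treeFiltration g val E η) := by
  intro α β h
  refine (treeFiltration_le_iff g).2 ⟨fun b γ hb => ?_, fun d hd hd' =>
    ladder_le_treeFiltration g hd (hd'.trans_le h)⟩
  obtain ⟨β', hβ', hb⟩ := hb
  exact branchSpan_le_treeFiltration g ⟨β', hβ'.trans_le h, hb⟩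

theorem treeFiltration_zero : treeFiltration g val E η 0 = ⊥ := by
  rw [eq_bot_iff, treeFiltration_le_iff]
  exact ⟨fun b γ ⟨β, hβ, _⟩ => absurd hβ not_lt_zero, fun d _ hd => absurd hd not_lt_zero⟩

/-- Because a segment needs a bound `β < α` rather than just values below `α`, each generator of a
limit stage appears at an earlier stage. -/
theorem mem_treeFiltration_of_isSuccLimit {α : Ordinal.{u}} (hα : Order.IsSuccLimit α)
    (x : ∀ w : J × (J → X), K w.1) :
    x ∈ treeFiltration g val E η α ↔ ∃ β < α, x ∈ treeFiltration g val E η β := by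
  have : Nonempty (Set.Iio α) := ⟨⟨0, hα.bot_lt⟩⟩
  have heq : treeFiltration g val E η α = ⨆ β : Set.Iio α, treeFiltration g val E η β := by
    apply le_antisymm
    · refine (treeFiltration_le_iff g).2 ⟨fun b γ ⟨β, hβ, hb⟩ => ?_, fun d hd hd' => ?_⟩
      · exact le_iSup_of_le ⟨β + 1, hα.add_one_lt hβ⟩
          (branchSpan_le_treeFiltration g ⟨β, lt_add_one β, hb⟩)
      · exact le_iSup_of_le ⟨val d + 1, hα.add_one_lt hd'⟩
          (ladder_le_treeFiltration g hd (lt_add_one _))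
    · exact iSup_le fun β => treeFiltration_mono g (le_of_lt β.2)
  rw [heq, Submodule.mem_iSup_of_directed (fun β : Set.Iio α => treeFiltration g val E η β)
    ((treeFiltration_mono g).comp (Subtype.mono_coe _)).directed_le]
  simp

theorem isFiltration_treeFiltration (l : Ordinal.{u}) :
    IsFiltration l fun α =>
      (treeFiltration g val E η α).submoduleOf (treeFiltration g val E η l) where
  zero := by
    simp [treeFiltration_zero, Submodule.submoduleOf]
  top := Submodule.submoduleOf_self _
  mono α β h _ := Submodule.comap_mono (treeFiltration_mono g h.le)
  limit α _ hα := by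
    ext x
    simp only [Set.mem_iUnion, Set.mem_Iio, exists_prop]
    exact mem_treeFiltration_of_isSuccLimit g hα x.1

/-- By `hbd`, segments with values below `val d` are already bounded strictly below it, so the
ladder of `d` is the only new generator. -/
theorem treeFiltration_add_one {d : X} (hval : Function.Injective val) (hd : val d ∈ E)
    (hbd : ∀ (b : J → X) (γ : J), (∀ i < γ, val (b i) < val d) →
      (b, γ) ∈ boundedNodes val J (val d)) :
    treeFiltration g val E η (val d + 1) =
      branchSpan g (η d, ⊤) ⊔ treeFiltration g val E η (val d) := by
  apply le_antisymm
  · refine (treeFiltration_le_iff g).2 ⟨fun b γ ⟨β, hβ, hb⟩ => ?_, fun d' hd' hlt => ?_⟩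
    · exact le_sup_of_le_right (branchSpan_le_treeFiltration g
        (hbd b γ fun i hi => (hb i hi).trans_le (Order.lt_add_one_iff.1 hβ)))
    · rcases (Order.lt_add_one_iff.1 hlt).lt_or_eq with h | h
      · exact le_sup_of_le_right (ladder_le_treeFiltration g hd' h)
      · exact hval h ▸ le_sup_left
  · exact sup_le (ladder_le_treeFiltration g hd (lt_add_one _))
      (treeFiltration_mono g (lt_add_one _).le)

theorem onBranch_mem_treeFiltration {d : X} (hη : ∀ i, val (η d i) < val d)
    (hbd : ∀ (b : J → X) (γ : J), (∀ i < γ, val (b i) < val d) →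
      (b, γ) ∈ boundedNodes val J (val d))
    {h : ∀ j, K j} (hh : h ∈ segSpanLT g ⊤) :
    onBranch S K (η d) h ∈ treeFiltration g val E η (val d) := by
  suffices segSpanLT g ⊤ ≤ (treeFiltration g val E η (val d)).comap (onBranch S K (η d)) from this hh
  refine segSpanLT_le_of_forall g fun γ hγ x hx => ?_
  lift γ to J using hγ.ne
  exact branchSpan_le_treeFiltration g (hbd (η d) γ fun i _ => hη i) ⟨x, hx, rfl⟩

/-- Segments have bounded length, and a ladder distinct from `η d` leaves it at some index. -/
theorem evalBranch_mem_of_mem_treeFiltration {d : X}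
    (hη : ∀ d', val d' ∈ E → val d' < val d → η d ≠ η d')
    {x : ∀ w : J × (J → X), K w.1} (hx : x ∈ treeFiltration g val E η (val d)) :
    evalBranch S K (η d) x ∈ segSpanLT g ⊤ := by
  have key : treeFiltration g val E η (val d) ≤
      (segSpanLT g ⊤).comap (evalBranch S K (η d)) := by
    refine (treeFiltration_le_iff g).2 ⟨fun b γ _ x hx => ?_, fun d' hd' hlt x hx => ?_⟩
    · refine segSpan_le_segSpanLT g ?_ (evalBranch_mem g hx)
      exact (min_le_right _ _).trans_lt (WithTop.coe_lt_top γ)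
    · obtain ⟨i, hi⟩ := exists_meet_eq (hη d' hd' hlt)
      refine segSpan_le_segSpanLT g ?_ (evalBranch_mem g hx)
      exact ((min_le_left _ _).trans hi).trans_lt (WithTop.coe_lt_top i)
  exact key hx

/-- The map `φ` after evaluation along `η d` is defined on the whole module, kills stage `val d`,
and on stage `val d + 1` has exactly that kernel. This single map gives the isomorphism and the
splitting in every later stage. -/
theorem treeFiltration_factor {l : Ordinal.{u}} (hl : Order.IsSuccLimit l)
    (hval : Function.Injective val) {d : X} (hdl : val d < l)
    (hd : val d ∈ E) (hη : ∀ i, val (η d i) < val d)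
    (hη' : ∀ d', val d' ∈ E → val d' < val d → η d ≠ η d')
    (hbd : ∀ (b : J → X) (γ : J), (∀ i < γ, val (b i) < val d) →
      (b, γ) ∈ boundedNodes val J (val d))
    {Y : Type u} [AddCommGroup Y] [Module S Y] (φ : segSpan g ⊤ →ₗ[S] Y)
    (hφ : Function.Surjective φ) (hker : ∀ h, φ h = 0 ↔ (h : ∀ j, K j) ∈ segSpanLT g ⊤)
    {ε : Ordinal.{u}} (hdε : val d < ε) :
    letI L := fun α => (treeFiltration g val E η α).submoduleOf (treeFiltration g val E η l)
    Nonempty (Y ≃ₗ[S] Factor (L (val d)) (L (val d + 1))) ∧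
      SplitsIn (L (val d)) (L (val d + 1)) (L ε) := by
  have hsucc := treeFiltration_add_one (η := η) g hval hd hbd
  constructor
  · obtain ⟨f, hf, hf'⟩ := exists_branch_factor g (s := (η d, ⊤)) φ hφ hker
      (U := treeFiltration g val E η (val d))
      (fun h hh => onBranch_mem_treeFiltration g hη hbd hh)
      (fun x hx => evalBranch_mem_of_mem_treeFiltration g hη' hx)
    obtain ⟨e⟩ := nonempty_factor_equiv hsucc f hf hf'
    obtain ⟨e'⟩ := nonempty_factor_submoduleOf_equiv (U := treeFiltration g val E η (val d))
      (treeFiltration_mono g (hl.add_one_lt hdl).le)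
    exact ⟨e ≪≫ₗ e'⟩
  · have hev : ∀ α, ∀ x ∈ treeFiltration g val E η α, evalBranch S K (η d) x ∈ segSpan g ⊤ := by
      intro α x hx
      suffices treeFiltration g val E η α ≤ (segSpan g ⊤).comap (evalBranch S K (η d)) from this hx
      exact (treeFiltration_le_iff g).2 ⟨fun b γ _ x hx => segSpan_mono g le_top (evalBranch_mem g hx),
        fun d' _ _ x hx => segSpan_mono g le_top (evalBranch_mem g hx)⟩
    let ρ : (treeFiltration g val E η l) →ₗ[S] Y :=
      φ ∘ₗ (evalBranch S K (η d)).restrict (hev l)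
    have hρ : ∀ x : treeFiltration g val E η l, ρ x = 0 ↔
        evalBranch S K (η d) x ∈ segSpanLT g ⊤ := fun x => hker _
    refine splitsIn_of_linearMap (ρ ∘ₗ Submodule.subtype _) (fun u => ?_) (fun q hq => ?_)
      fun q hq h0 => ?_
    -- Copying the values of `u` along `η d` back onto that branch gives an element of stage `val d
    -- + 1` with the same image.
    · let y : ∀ w : J × (J → X), K w.1 := onBranch S K (η d) (evalBranch S K (η d) u.1.1)
      have hy : y ∈ branchSpan g (η d, ⊤) := ⟨_, hev l _ u.1.2, rfl⟩
      have hy1 : y ∈ treeFiltration g val E η (val d + 1) := by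
        rw [hsucc]
        exact Submodule.mem_sup_left hy
      have hyε : y ∈ treeFiltration g val E η ε := ladder_le_treeFiltration g hd hdε hy
      have hyl : y ∈ treeFiltration g val E η l := ladder_le_treeFiltration g hd hdl hy
      refine ⟨⟨⟨y, hyl⟩, hyε⟩, hy1, congrArg φ (Subtype.ext ?_)⟩
      exact evalBranch_onBranch_self (S := S) (η d) _
    · exact (hρ _).2 (evalBranch_mem_of_mem_treeFiltration g hη' hq)
    · have hev0 := (hρ _).1 h0
      have hq' : (q.1.1 : ∀ w : J × (J → X), K w.1) ∈
          branchSpan g (η d, ⊤) ⊔ treeFiltration g val E η (val d) := hsucc ▸ hq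
      obtain ⟨_, ⟨h, hh, rfl⟩, z, hz, hsum⟩ := Submodule.mem_sup.1 hq'
      change (q.1.1 : ∀ w : J × (J → X), K w.1) ∈ treeFiltration g val E η (val d)
      have hev1 : evalBranch S K (η d) (q.1.1 : ∀ w : J × (J → X), K w.1) ∈ segSpanLT g ⊤ := hev0
      rw [← hsum, map_add, evalBranch_onBranch_self] at hev1
      rw [← hsum]
      refine add_mem (onBranch_mem_treeFiltration g hη hbd ?_) hz
      have := sub_mem hev1 (evalBranch_mem_of_mem_treeFiltration g hη' hz)
      rwa [add_sub_cancel_right] at this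

theorem mk_sigma_le_of_le {I : Type u} {F : I → Type u} {κ : Cardinal.{u}} (hκ : ℵ₀ ≤ κ)
    (hI : #I ≤ κ) (hF : ∀ i, #(F i) ≤ κ) : #(Σ i, F i) ≤ κ := by
  rw [mk_sigma]
  refine (sum_le_sum _ _ hF).trans ?_
  rw [sum_const, lift_id, lift_id]
  exact mul_le_of_le hκ hI le_rfl

/-- A segment of length `γ` is determined by fewer than `θ` values taken from a set of size at most
`κ`, so `κ ^< θ = κ` bounds their number. -/
theorem mk_treeFiltration_le [Nonempty X] {κ θ : Cardinal.{u}} (hκ : ℵ₀ ≤ κ) (hS : #S ≤ κ)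
    (hJ : #J ≤ κ) (hK : ∀ i, #(K i) ≤ κ) (hθ : ∀ γ : J, #(Set.Iio γ) < θ) (hpow : κ ^< θ = κ)
    {α : Ordinal.{u}} (hX : #{x : X // val x < α} ≤ κ) : #(treeFiltration g val E η α) ≤ κ := by
  classical
  let x₀ := Classical.arbitrary X
  -- Normal forms: sequences constantly `x₀` from their length on.
  let B' : Set ((J → X) × J) :=
    {p | p ∈ boundedNodes val J α ∧ ∀ i, p.2 ≤ i → p.1 i = x₀}
  have hB' : #B' ≤ κ := by
    let F : B' → Σ γ : J, (Set.Iio γ → {x : X // val x < α}) := fun p =>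
      ⟨p.1.2, fun i => ⟨p.1.1 i, by
        obtain ⟨β, hβ, h⟩ := p.2.1
        exact (h i i.2).trans hβ⟩⟩
    have hF : Function.Injective F := by
      rintro ⟨⟨b, γ⟩, h1, h2⟩ ⟨⟨b', γ'⟩, h1', h2'⟩ h
      obtain rfl : γ = γ' := congrArg Sigma.fst h
      have h3 := eq_of_heq (Sigma.mk.inj h).2
      have : b = b' := by
        ext i
        by_cases hi : i < γ
        · exact congrArg Subtype.val (congrFun h3 ⟨i, hi⟩)
        · exact (h2 i (not_lt.1 hi)).trans (h2' i (not_lt.1 hi)).symm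
      subst this
      rfl
    refine (mk_le_of_injective hF).trans (mk_sigma_le_of_le hκ hJ fun γ => ?_)
    have : #(Set.Iio γ → {x : X // val x < α}) = #{x : X // val x < α} ^ #(Set.Iio γ) := by
      rw [power_def]
    rw [this]
    calc _ ≤ κ ^ #(Set.Iio γ) := power_le_power_right hX
      _ ≤ κ ^< θ := le_powerlt κ (hθ γ)
      _ = κ := hpow
  refine mk_treeSpan_le g hκ hS hJ (mk_sigma_le_of_le hκ hJ hK) hB' (fun b γ hb => ?_) ?_ _
  · let b' : J → X := fun i => if i < γ then b i else x₀
    refine ⟨b', ⟨?_, fun i hi => if_neg (not_lt.2 hi)⟩, ?_⟩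
    · obtain ⟨β, hβ, h⟩ := hb
      refine ⟨β, hβ, fun i hi => ?_⟩
      simp only [b', if_pos (show i < γ from hi)]
      exact h i hi
    · by_contra hlt
      rw [not_le] at hlt
      obtain ⟨m, hm⟩ := WithTop.ne_top_iff_exists.1 (hlt.trans_le le_top).ne
      rw [← hm, WithTop.coe_lt_coe] at hlt
      have : (m : WithTop J) < meet b b' :=
        lt_meet_iff.2 fun i hi => (if_pos (hi.trans_lt hlt)).symm
      exact absurd hm this.ne
  · refine (mk_le_of_injective (f := fun d => (⟨d.1, d.2.2⟩ : {x : X // val x < α})) ?_).trans hX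
    intro d d' h
    exact Subtype.ext (congrArg (fun x : {x : X // val x < α} => x.1) h)

end TreeFiltration

end EnochsTree

/-! ### The construction over the ladder system on `E`. -/

theorem proposition3p3 {R : Type u} [Ring R]
    (A : CategoryTheory.ObjectProperty (ModuleCat.{u} Rᵐᵒᵖ)) [A.IsClosedUnderIsomorphisms]
    (hpure : EnochsTree.ClosedUnderPureFiltrations A)
    (hsummand : EnochsTree.ClosedUnderSummands A)
    (θ : Cardinal.{u}) (hθ : θ.IsRegular)
    (N : θ.ord.ToType → Type u) [∀ α, AddCommGroup (N α)] [∀ α, Module Rᵐᵒᵖ (N α)]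
    (g : ∀ β α, β ≤ α → N β →ₗ[Rᵐᵒᵖ] N α) [DirectedSystem N fun β α h => g β α h]
    (hcont : EnochsTree.IsContinuousSystem θ N g)
    (hN : ∀ α, A (ModuleCat.of Rᵐᵒᵖ (N α)))
    (κ : Cardinal.{u}) (hκ : #R + Cardinal.sum (fun α => #(N α)) ≤ κ)
    (hsuit : EnochsTree.IsSuitable θ κ) :
    ∃ F : Set Ordinal.{u}, F ⊆ Set.Iio (Order.succ κ).ord ∧
      EnochsTree.StationaryIn (Order.succ κ).ord F ∧
      ∃ (M : ModuleCat.{u} Rᵐᵒᵖ) (L : Ordinal.{u} → Submodule Rᵐᵒᵖ M),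
        EnochsTree.IsFiltration (Order.succ κ).ord L ∧
        (∀ α < (Order.succ κ).ord,
          A (ModuleCat.of Rᵐᵒᵖ (L α)) ∧ #(L α) < Order.succ κ) ∧
        ∀ δ ∈ F, ∀ ε, δ < ε → ε < (Order.succ κ).ord →
          Nonempty (Module.DirectLimit N g ≃ₗ[Rᵐᵒᵖ] EnochsTree.Factor (L δ) (L (δ + 1))) ∧
          EnochsTree.SplitsIn (L δ) (L (δ + 1)) (L ε) := by
  classical
  have hθ₀ : ℵ₀ ≤ θ := hθ.aleph0_le
  have : NoMaxOrder θ.ord.ToType := Cardinal.noMaxOrder hθ₀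
  have : Nonempty θ.ord.ToType := by
    rw [Ordinal.nonempty_toType_iff, Ne, Cardinal.ord_eq_zero]
    exact (aleph0_pos.trans_le hθ₀).ne'
  have hSκ : #Rᵐᵒᵖ ≤ κ := by
    rw [mk_congr MulOpposite.opEquiv.symm]
    exact (self_le_add_right _ _).trans hκ
  have hsum : Cardinal.sum (fun α => #(N α)) ≤ κ := (self_le_add_left _ _).trans hκ
  have hJκ : #θ.ord.ToType ≤ κ := by
    -- Every `N i` contains `0`, so the index set embeds into the disjoint union of the modules.
    refine le_trans ?_ hsum
    rw [← mk_sigma]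
    exact mk_le_of_injective (f := fun i => (⟨i, 0⟩ : Σ i, N i)) fun i j h => congrArg Sigma.fst h
  have hθκ : θ ≤ κ := by simpa using hJκ
  have hκ₀ : ℵ₀ ≤ κ := hθ₀.trans hθκ
  have hNκ : ∀ i, #(N i) ≤ κ := fun i => (le_sum (fun α => #(N α)) i).trans hsum
  set l : Ordinal.{u} := (Order.succ κ).ord with hl
  have hllim : Order.IsSuccLimit l := isSuccLimit_ord (hκ₀.trans (Order.le_succ κ))
  obtain ⟨E, hEl, hEst, hEnr, hEcof⟩ := hsuit.exists_nonReflecting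
  have hElim : ∀ δ ∈ E, Order.IsSuccLimit δ := fun δ hδ =>
    EnochsTree.isSuccLimit_of_aleph0_le_cof (hEcof δ hδ ▸ hθ₀)
  choose! a ha ha' using fun δ (hδ : δ ∈ E) => EnochsTree.exists_ladder hθ₀ (hEcof δ hδ)
  let X := l.ToType
  let val : X → Ordinal.{u} := fun x => (Ordinal.ToType.mk.symm x : Set.Iio l)
  have hval : Function.Injective val := Subtype.val_injective.comp (OrderIso.injective _)
  have hvall : ∀ x, val x < l := fun x => (Ordinal.ToType.mk.symm x : Set.Iio l).2
  have hvalsurj : ∀ o < l, ∃ x, val x = o := fun o ho =>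
    ⟨Ordinal.ToType.mk ⟨o, ho⟩, by simp [val]⟩
  have : Nonempty X := ⟨(hvalsurj 0 hllim.bot_lt).choose⟩
  have hX : ∀ α < l, #{x : X // val x < α} ≤ κ := by
    intro α hα
    obtain ⟨x, rfl⟩ := hvalsurj α hα
    rw [← Order.lt_succ_iff]
    refine lt_of_le_of_lt ?_ (EnochsTree.mk_Iio_ordToType_lt x)
    exact mk_le_of_injective
      (f := fun y : {y : X // val y < val x} =>
        (⟨y.1, (OrderIso.lt_iff_lt Ordinal.ToType.mk.symm).1 y.2⟩ : Set.Iio x))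
      fun y z h => Subtype.ext (congrArg (fun x : Set.Iio _ => x.1) h)
  have hηex : ∀ d : X, ∃ b : θ.ord.ToType → X, val d ∈ E → ∀ i, val (b i) = a (val d) i := by
    intro d
    by_cases hd : val d ∈ E
    · choose b hb using fun i => hvalsurj _ ((ha _ hd i).trans (hvall d))
      exact ⟨b, fun _ => hb⟩
    · exact ⟨fun _ => d, fun h => absurd h hd⟩
  choose η hη using hηex
  have hηlt : ∀ d, val d ∈ E → ∀ i, val (η d i) < val d := fun d hd i => by
    rw [hη d hd]
    exact ha _ hd i
  have hηne : ∀ d, val d ∈ E → ∀ d', val d' ∈ E → val d' < val d → η d ≠ η d' := by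
    intro d hd d' hd' hlt h
    obtain ⟨i, hi⟩ := ha' _ hd _ hlt
    have h1 := hi i le_rfl
    rw [← hη d hd, h] at h1
    exact lt_asymm h1 (hηlt d' hd' i)
  have hbd : ∀ d, val d ∈ E → ∀ (b : θ.ord.ToType → X) (γ : θ.ord.ToType),
      (∀ i < γ, val (b i) < val d) → (b, γ) ∈ EnochsTree.boundedNodes val θ.ord.ToType (val d) := by
    intro d hd b γ hb
    -- Fewer than `θ` ordinals below `val d`, whose cofinality is `θ`, have a common strict bound
    -- below it.
    refine ⟨⨆ i : Set.Iio γ, val (b i) + 1, ?_, fun i hi => ?_⟩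
    · refine Ordinal.iSup_add_one_lt_of_lt_cof ?_ fun i => hb i i.2
      rw [hEcof _ hd]
      exact EnochsTree.mk_Iio_ordToType_lt γ
    · exact (lt_add_one _).trans_le
        (Ordinal.le_iSup (fun i : Set.Iio γ => val (b i) + 1) ⟨i, hi⟩)
  let T := EnochsTree.treeFiltration (EnochsTree.succMap g) val E η
  refine ⟨E, hEl, hEst, ModuleCat.of Rᵐᵒᵖ (T l), fun α => (T α).submoduleOf (T l),
    EnochsTree.isFiltration_treeFiltration _ l, fun α hα => ?_, fun δ hδ ε hδε hε => ?_⟩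
  · let e : ((T α).submoduleOf (T l)) ≃ₗ[Rᵐᵒᵖ] T α :=
      Submodule.submoduleOfEquivOfLe (EnochsTree.treeFiltration_mono _ hα.le)
    constructor
    · refine EnochsTree.mem_of_equiv e.symm ?_
      -- The lower bound `0` excludes nothing, since the elements of `E` are limit ordinals.
      obtain ⟨f, -, hf⟩ := EnochsTree.exists_free hElim hEnr a ha ha' α hα 0
      refine hpure.treeModule (EnochsTree.succMap g) (fun i => hN _)
        (EnochsTree.exists_step g hpure hN hcont EnochsTree.mk_Iio_ordToType_lt) _ ?_ _ ?_
        (fun d => f (val d)) ?_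
      · rintro b γ γ' hγ ⟨β, hβ, h⟩
        exact ⟨β, hβ, fun i hi => h i (lt_trans hi hγ)⟩
      · exact fun d γ => ⟨val d, d.2.2, fun i _ => hηlt d d.2.1 i⟩
      · intro d d' hdd'
        obtain ⟨i, hi, hne⟩ := hf (val d) d.2.1 (hElim _ d.2.1).bot_lt d.2.2 (val d') d'.2.1
          (hElim _ d'.2.1).bot_lt d'.2.2 fun h => hdd' (Subtype.ext (hval h))
        have hne' : η d i ≠ η d' i := fun h => hne (by
          rw [← hη d d.2.1, ← hη d' d'.2.1, h])
        refine (EnochsTree.meet_le_of_ne hne').trans ?_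
        exact WithTop.coe_le_coe.2 hi
    · rw [Order.lt_succ_iff, mk_congr e.toEquiv]
      exact EnochsTree.mk_treeFiltration_le _ hκ₀ hSκ hJκ (fun i => hNκ _)
        EnochsTree.mk_Iio_ordToType_lt hsuit.powerlt_eq (hX α hα)
  · obtain ⟨d, rfl⟩ := hvalsurj δ (hEl hδ)
    obtain ⟨φ, hφ, hker⟩ := EnochsTree.exists_map_directLimit g
    exact EnochsTree.treeFiltration_factor (EnochsTree.succMap g) hllim hval (hvall d) hδ
      (hηlt d hδ) (hηne d hδ) (hbd d hδ) φ hφ hker hδε
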